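/- **Conventions.** A smooth manifold is a space with a smooth ($C^\infty$) atlas modelled on $\mathbb R^n$, without boundary; it need be neither Hausdorff nor second countable (it is always $T_1$). All sets below live in one fixed universe. Let $X$ be a smooth $n$-manifold. *Étale Lie groupoids.* An étale Lie groupoid over $X$ is a groupoid $\mathcal G$ with set of objects $X$ whose set of arrows $\mathcal G_1$ is a smooth $n$-manifold, whose source and target maps $s,t:\mathcal G_1\to X$ are local diffeomorphisms, and whose unit, inversion and composition maps are smooth. An isomorphism of étale Lie groupoids over $X$ is an isomorphism of groupoids that is the identity on $X$ and a diffeomorphism on arrows. *Pseudogroup sheaves.* Let $X_{top}$ be the poset of open subsets of $X$, viewed as a category, and let $\mathcal C$ be a small category with set of objects $\mathrm{Ob}(X_{top})$ together with a functor $X_{top}\to\mathcal C$ that is the identity on objects. For each open $V$, $\mathcal C(-,V)$ is then a presheaf on $X$. Put $\mathcal C_x(V)=\varinjlim_{U\ni x}\mathcal C(U,V)$ and $\mathcal C_x^y=\varprojlim_{V\ni y}\mathcal C_x(V)$ for $x,y\in X$. Composition in $\mathcal C$ induces maps $\mathcal C_y^z\times\mathcal C_x^y\to\mathcal C_x^z$,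 which give a category $\mathcal C^\star$ with object set $X$ and $\mathcal C^\star(x,y)=\mathcal C_x^y$. The category $\mathcal C$ is a pseudogroup sheaf on $X$ if 1. for every $x\in X$ and every open $V$, the map $\coprod_{y\in V}\mathcal C_x^y\to\mathcal C_x(V)$ given by the projections is bijective; 2. the category $\mathcal C^\star$ is a groupoid; 3. the presheaf $\mathcal C(-,V)$ is a sheaf for every open $V$. Each $f\in\mathcal C(U,V)$ then has an underlying map $\bar f:U\to V$, where $\bar f(x)$ is the unique $y\in V$ such that the germ $f_x\in\mathcal C_x(V)$ comes from $\mathcal C_x^y$. The pseudogroup sheaf is smooth if $\bar f$ is smooth for all $U,V$ and all $f\in\mathcal C(U,V)$. An isomorphism of pseudogroup sheaves on $X$ is an isomorphism of categories that is the identity on objects and on the morphisms coming from $X_{top}$. **Theorem.** There is a one-to-one correspondence $\Phi$ between isomorphism classes of étale Lie groupoids over $X$ and isomorphism classes of smooth pseudogroup sheaves on $X$. For every étale Lie groupoid $\mathcal G$ over $X$ and every smooth pseudogroup sheaf $\mathcal C$ on $X$: * $\Phi([\mathcal G])=[\mathcal C]$ if and only if $\mathcal C$ is isomorphic (over $X_{top}$)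 to the category $\hat{\mathcal G}$ with $$\hat{\mathcal G}(U,V)=\{f:U\to t^{-1}(V)\ \text{continuous}\mid s\circ f=\mathrm{id}_U\},\qquad (g\circ f)(x)=g\big(t(f(x))\big)\circ f(x),$$ in which an inclusion $U\subseteq V$ corresponds to the unit section over $U$. (Such sections $f$ are automatically smooth.) * $\Phi^{-1}([\mathcal C])=[\mathcal G]$ if and only if $\mathcal G$ is isomorphic, as a topological groupoid over $X$, to $\mathcal C^\star$, where the arrows of $\mathcal C^\star$ carry the topology generated by the sets $[f,U]=\{f_x\mid x\in U\}$ for $U$ open and $f\in\mathcal C(U,X)$. -/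

import Mathlib

open Set TopologicalSpace CategoryTheory Opposite
open scoped Manifold ContDiff

universe u

namespace EtalePG

/-! ### Categories on the open sets of a space -/

/-- A small category `C` whose objects are the open sets of `X`, with an identity-on-objects functor
`incl` from the poset `X_top` of open sets (automatically an embedding, since `X_top` is a poset).
`comp g f` is `g ∘ f`. -/
structure OpenCat (X : Type u) [TopologicalSpace X] where
  Hom : Opens X → Opens X → Type u
  id : ∀ U : Opens X, Hom U U
  comp : ∀ {U V W : Opens X}, Hom V W → Hom U V → Hom U W
  id_comp : ∀ {U V : Opens X} (f : Hom U V), comp (id V) f = f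
  comp_id : ∀ {U V : Opens X} (f : Hom U V), comp f (id U) = f
  assoc : ∀ {U V W Z : Opens X} (h : Hom W Z) (g : Hom V W) (f : Hom U V),
    comp (comp h g) f = comp h (comp g f)
  incl : ∀ {U V : Opens X}, U ≤ V → Hom U V
  incl_refl : ∀ U : Opens X, incl (le_refl U) = id U
  incl_trans : ∀ {U V W : Opens X} (h : U ≤ V) (k : V ≤ W),
    incl (h.trans k) = comp (incl k) (incl h)

namespace OpenCat

variable {X : Type u} [TopologicalSpace X] (C : OpenCat X)

/-- Restriction `f|_{U'}` of `f ∈ C(U, V)` to a smaller open set `U'`. -/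
def restrict {U U' V : Opens X} (h : U' ≤ U) (f : C.Hom U V) : C.Hom U' V :=
  C.comp f (C.incl h)

theorem restrict_self {U V : Opens X} (f : C.Hom U V) : C.restrict (le_refl U) f = f := by
  rw [restrict, C.incl_refl, C.comp_id]

theorem restrict_restrict {U U' U'' V : Opens X} (h : U' ≤ U) (k : U'' ≤ U') (f : C.Hom U V) :
    C.restrict k (C.restrict h f) = C.restrict (k.trans h) f := by
  simp only [restrict, C.incl_trans k h, C.assoc]

theorem restrict_comp {U U' V W : Opens X} (h : U' ≤ U) (g : C.Hom V W) (f : C.Hom U V) :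
    C.restrict h (C.comp g f) = C.comp g (C.restrict h f) := C.assoc _ _ _

/-- The presheaf `C(-, V)` on `X`. -/
def presheaf (V : Opens X) : TopCat.Presheaf (Type u) (TopCat.of X) where
  obj U := C.Hom U.unop V
  map i := ↾(fun f => C.restrict i.unop.le f)
  map_id U := by
    ext f
    exact C.restrict_self f
  map_comp i j := by
    ext f
    exact (C.restrict_restrict i.unop.le j.unop.le f).symm

/-- Two elements of `⨆_{U ∋ x} C(U, V)` have the same germ at `x`. -/
def germSetoid (x : X) (V : Opens X) : Setoid (Σ U : {U : Opens X // x ∈ U}, C.Hom U.1 V) where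
  r f g := ∃ (W : Opens X) (_ : x ∈ W) (h : W ≤ f.1.1) (k : W ≤ g.1.1),
    C.restrict h f.2 = C.restrict k g.2
  iseqv :=
    { refl := fun f => ⟨f.1.1, f.1.2, le_rfl, le_rfl, rfl⟩
      symm := fun ⟨W, hx, h, k, e⟩ => ⟨W, hx, k, h, e.symm⟩
      trans := by
        rintro f g l ⟨W, hx, h, k, e⟩ ⟨W', hx', h', k', e'⟩
        refine ⟨W ⊓ W', ⟨hx, hx'⟩, inf_le_left.trans h, inf_le_right.trans k', ?_⟩
        rw [← C.restrict_restrict h inf_le_left, e, C.restrict_restrict,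
          ← C.restrict_restrict k' inf_le_right, ← e', C.restrict_restrict] }

/-- `C_x(V) = colim_{U ∋ x} C(U, V)`, the stalk at `x` of the presheaf `C(-, V)`. -/
def Stalk (x : X) (V : Opens X) : Type u := Quotient (C.germSetoid x V)

/-- The germ `f_x ∈ C_x(V)` of `f ∈ C(U, V)` at `x ∈ U`. -/
def germ {U V : Opens X} (x : X) (hx : x ∈ U) (f : C.Hom U V) : C.Stalk x V :=
  Quotient.mk (C.germSetoid x V) ⟨⟨U, hx⟩, f⟩

theorem germ_restrict {U U' V : Opens X} (x : X) (h : U' ≤ U) (hx : x ∈ U') (f : C.Hom U V) :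
    C.germ x hx (C.restrict h f) = C.germ x (h hx) f :=
  Quotient.sound ⟨U', hx, le_rfl, h, C.restrict_self _⟩

/-- Postcomposition with `g ∈ C(V, W)` as a map `C_x(V) → C_x(W)`. -/
def push (x : X) {V W : Opens X} (g : C.Hom V W) : C.Stalk x V → C.Stalk x W :=
  Quotient.lift (fun f => C.germ x f.1.2 (C.comp g f.2)) (by
    rintro f f' ⟨N, hx, h, k, e⟩
    refine Quotient.sound ⟨N, hx, h, k, ?_⟩
    change C.restrict h (C.comp g f.2) = C.restrict k (C.comp g f'.2)
    rw [C.restrict_comp, e, C.restrict_comp])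

theorem push_germ {U V W : Opens X} (x : X) (hx : x ∈ U) (g : C.Hom V W) (f : C.Hom U V) :
    C.push x g (C.germ x hx f) = C.germ x hx (C.comp g f) := rfl

theorem push_id (x : X) {V : Opens X} (a : C.Stalk x V) : C.push x (C.id V) a = a := by
  refine Quotient.inductionOn a fun f => ?_
  change C.germ x f.1.2 (C.comp (C.id V) f.2) = C.germ x f.1.2 f.2
  rw [C.id_comp]

theorem push_push (x : X) {V W Z : Opens X} (h : C.Hom W Z) (g : C.Hom V W) (a : C.Stalk x V) :
    C.push x h (C.push x g a) = C.push x (C.comp h g) a := by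
  refine Quotient.inductionOn a fun f => ?_
  change C.germ x f.1.2 (C.comp h (C.comp g f.2)) = C.germ x f.1.2 (C.comp (C.comp h g) f.2)
  rw [C.assoc]

/-- `C_x^y = lim_{V ∋ y} C_x(V)`, the compatible families of germs `a_V ∈ C_x(V)`, `V ∋ y`. -/
@[ext]
structure StarHom (x y : X) where
  proj : ∀ V : Opens X, y ∈ V → C.Stalk x V
  compat : ∀ {V V' : Opens X} (h : V ≤ V') (hy : y ∈ V),
    C.push x (C.incl h) (proj V hy) = proj V' (h hy)

variable {C}

/-- For `b ∈ C_y(W)` and `a ∈ C_x^y`, the composite `b ∘ a ∈ C_x(W)`: if `b` is the germ of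
`g ∈ C(V, W)`, it is the image of `a_V ∈ C_x(V)` under `g`. -/
def germComp {x y : X} {W : Opens X} (b : C.Stalk y W) (a : C.StarHom x y) : C.Stalk x W :=
  Quotient.lift (fun g : (Σ V : {V : Opens X // y ∈ V}, C.Hom V.1 W) =>
      C.push x g.2 (a.proj g.1.1 g.1.2)) (by
    rintro ⟨⟨V, hV⟩, g⟩ ⟨⟨V', hV'⟩, g'⟩ ⟨N, hy, h, k, e⟩
    change C.push x g (a.proj V hV) = C.push x g' (a.proj V' hV')
    rw [← a.compat h hy, ← a.compat k hy, C.push_push, C.push_push]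
    exact congrArg (fun m => C.push x m (a.proj N hy)) e) b

theorem germComp_germ {x y : X} {V W : Opens X} (hy : y ∈ V) (g : C.Hom V W)
    (a : C.StarHom x y) : germComp (C.germ y hy g) a = C.push x g (a.proj V hy) := rfl

theorem push_germComp {x y : X} {W Z : Opens X} (h : C.Hom W Z) (b : C.Stalk y W)
    (a : C.StarHom x y) : C.push x h (germComp b a) = germComp (C.push y h b) a := by
  refine Quotient.inductionOn b fun g => ?_
  exact C.push_push x h g.2 _

/-- The composition `C_y^z × C_x^y → C_x^z`. -/
def starComp {x y z : X} (b : C.StarHom y z) (a : C.StarHom x y) : C.StarHom x z where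
  proj W hW := germComp (b.proj W hW) a
  compat h hz := by rw [push_germComp, b.compat]

/-- The identity in `C_x^x`, the family of the germs of `id_V`, `V ∋ x`. -/
def starId (C : OpenCat X) (x : X) : C.StarHom x x where
  proj V hV := C.germ x hV (C.id V)
  compat {V V'} h hx := by
    rw [push_germ, C.comp_id, ← C.germ_restrict x h hx (C.id V'), restrict, C.id_comp]

variable (C)

/-- The set of objects of the category `C⋆`, namely `X`. -/
@[nolint unusedArguments]
def Star (_ : OpenCat X) : Type u := X

/-- The category `C⋆` with objects the points of `X` and `C⋆(x, y) = C_x^y`. -/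
instance : Category.{u} (Star C) where
  Hom x y := C.StarHom (X := X) x y
  id x := starId C x
  comp a b := starComp b a
  id_comp {x y} b := by
    apply StarHom.ext
    funext W hW
    change germComp (b.proj W hW) (starId C x) = b.proj W hW
    generalize b.proj W hW = c
    refine Quotient.inductionOn c fun g => ?_
    change C.germ x g.1.2 (C.comp g.2 (C.id g.1.1)) = C.germ x g.1.2 g.2
    rw [C.comp_id]
  comp_id {x y} a := by
    apply StarHom.ext
    funext W hW
    exact C.push_id x _
  assoc {x y z w} a b c := by
    apply StarHom.ext
    funext W hW
    change germComp (c.proj W hW) (starComp b a) = germComp (germComp (c.proj W hW) b) a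
    generalize c.proj W hW = d
    refine Quotient.inductionOn d fun h => ?_
    exact push_germComp h.2 _ _

/-- The map `∐_{y ∈ V} C_x^y → C_x(V)` whose restriction to each `C_x^y` is the projection. -/
def coprodToStalk (x : X) (V : Opens X) : (Σ y : V, C.StarHom x (y : X)) → C.Stalk x V :=
  fun a => a.2.proj V a.1.2

/-- Pseudogroup sheaves on a T₁ space `X`. -/
structure IsPseudogroupSheaf : Prop where
  decomp : ∀ (x : X) (V : Opens X), Function.Bijective (C.coprodToStalk x V)
  groupoid : IsGroupoid (Star C)
  sheaf : ∀ V : Opens X, (C.presheaf V).IsSheaf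

variable {C}

/-- The underlying map `f̄ : U → V` of `f ∈ C(U, V)`: `f̄ x` is the unique `y ∈ V` with
`f_x ∈ C_x^y`. -/
noncomputable def underlying (hC : C.IsPseudogroupSheaf) {U V : Opens X} (f : C.Hom U V)
    (x : U) : V :=
  ((Equiv.ofBijective _ (hC.decomp x V)).symm (C.germ (x : X) x.2 f)).1

/-- An isomorphism of categories `C ≅ D` which is the identity on objects and on `X_top`. -/
structure Iso (C D : OpenCat X) where
  toEquiv : ∀ U V : Opens X, C.Hom U V ≃ D.Hom U V
  map_comp : ∀ {U V W : Opens X} (g : C.Hom V W) (f : C.Hom U V),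
    toEquiv U W (C.comp g f) = D.comp (toEquiv V W g) (toEquiv U V f)
  map_incl : ∀ {U V : Opens X} (h : U ≤ V), toEquiv U V (C.incl h) = D.incl h

def Iso.refl (C : OpenCat X) : Iso C C where
  toEquiv _ _ := Equiv.refl _
  map_comp _ _ := rfl
  map_incl _ := rfl

def Iso.symm {C D : OpenCat X} (e : Iso C D) : Iso D C where
  toEquiv U V := (e.toEquiv U V).symm
  map_comp g f := by
    rw [Equiv.symm_apply_eq, e.map_comp]
    simp
  map_incl h := by rw [Equiv.symm_apply_eq, e.map_incl]

def Iso.trans {C D E : OpenCat X} (e : Iso C D) (e' : Iso D E) : Iso C E where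
  toEquiv U V := (e.toEquiv U V).trans (e'.toEquiv U V)
  map_comp g f := by simp [e.map_comp, e'.map_comp]
  map_incl h := by simp [e.map_incl, e'.map_incl]

variable (C)

/-- The set of arrows of `C⋆`. -/
structure StarArrow where
  src : X
  tgt : X
  hom : C.StarHom src tgt

/-- The set `[f, U] = {f_x | x ∈ U}` of arrows of `C⋆`, for `f ∈ C(U, X)`. -/
def basicArrows {U : Opens X} (f : C.Hom U ⊤) : Set C.StarArrow :=
  {a | ∃ h : a.src ∈ U, a.hom.proj ⊤ trivial = C.germ a.src h f}

/-- The topology of the étale space of `C(-, X)` on the set of arrows of `C⋆`. -/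
instance : TopologicalSpace C.StarArrow :=
  TopologicalSpace.generateFrom {S | ∃ (U : Opens X) (f : C.Hom U ⊤), S = C.basicArrows f}

end OpenCat

/-! ### Topological étale groupoids and étale Lie groupoids -/

/-- A topological étale groupoid over `X`: the space of objects is `X`, `Arr` is the space of arrows,
and `comp g f h` is `g ∘ f`. -/
structure EtaleGroupoid (X : Type u) [TopologicalSpace X] where
  Arr : Type u
  [top : TopologicalSpace Arr]
  s : Arr → X
  t : Arr → X
  unit : X → Arr
  inv : Arr → Arr
  comp : ∀ g f : Arr, s g = t f → Arr
  s_unit : ∀ x, s (unit x) = x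
  t_unit : ∀ x, t (unit x) = x
  s_inv : ∀ g, s (inv g) = t g
  t_inv : ∀ g, t (inv g) = s g
  s_comp : ∀ g f h, s (comp g f h) = s f
  t_comp : ∀ g f h, t (comp g f h) = t g
  comp_unit : ∀ g, comp g (unit (s g)) (t_unit _).symm = g
  unit_comp : ∀ g, comp (unit (t g)) g (s_unit _) = g
  assoc : ∀ (k g f : Arr) (h₁ : s k = t g) (h₂ : s g = t f),
    comp (comp k g h₁) f ((s_comp _ _ _).trans h₂) = comp k (comp g f h₂) (h₁.trans (t_comp _ _ _).symm)
  inv_comp : ∀ g, comp (inv g) g (s_inv g) = unit (s g)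
  comp_inv : ∀ g, comp g (inv g) (t_inv g).symm = unit (t g)
  continuous_unit : Continuous unit
  continuous_inv : Continuous inv
  continuous_comp : Continuous fun p : {p : Arr × Arr // s p.1 = t p.2} => comp p.1.1 p.1.2 p.2
  isLocalHomeomorph_s : IsLocalHomeomorph s
  isLocalHomeomorph_t : IsLocalHomeomorph t

attribute [instance] EtaleGroupoid.top

namespace EtaleGroupoid

variable {X : Type u} [TopologicalSpace X] (G : EtaleGroupoid X)

theorem comp_congr {g g' f f' : G.Arr} (hg : g = g') (hf : f = f') (h : G.s g = G.t f) :
    G.comp g f h = G.comp g' f' (hg ▸ hf ▸ h) := by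
  subst hg hf
  rfl

/-- `Ĝ(U, V)`: the continuous sections `f : U → t⁻¹(V)` of the source map over `U`. -/
@[ext]
structure Sect (U V : Opens X) where
  toFun : U → G.Arr
  continuous : Continuous toFun
  s_apply : ∀ x, G.s (toFun x) = x
  t_mem : ∀ x, G.t (toFun x) ∈ V

variable {G}

/-- The map `U → V`, `x ↦ t (f x)`, induced by `f ∈ Ĝ(U, V)`. -/
def Sect.target {U V : Opens X} (f : G.Sect U V) (x : U) : V := ⟨G.t (f.toFun x), f.t_mem x⟩

/-- The composition of `Ĝ`: `(g ∘ f)(x) = g(t(f(x))) ∘ f(x)`. -/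
def Sect.comp {U V W : Opens X} (g : G.Sect V W) (f : G.Sect U V) : G.Sect U W where
  toFun x := G.comp (g.toFun (f.target x)) (f.toFun x) (g.s_apply _)
  continuous := by
    have hf : Continuous f.target :=
      (G.isLocalHomeomorph_t.continuous.comp f.continuous).subtype_mk _
    exact G.continuous_comp.comp
      (((g.continuous.comp hf).prodMk f.continuous).subtype_mk fun x => g.s_apply _)
  s_apply x := (G.s_comp _ _ (g.s_apply _)).trans (f.s_apply x)
  t_mem x := by
    have h := G.t_comp (g.toFun (f.target x)) (f.toFun x) (g.s_apply _)
    exact h.symm ▸ g.t_mem _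

/-- The unit section over `U`, as the element of `Ĝ(U, V)` given by an inclusion `U ⊆ V`. -/
def Sect.incl (G : EtaleGroupoid X) {U V : Opens X} (h : U ≤ V) : G.Sect U V where
  toFun x := G.unit x
  continuous := G.continuous_unit.comp continuous_subtype_val
  s_apply x := G.s_unit x
  t_mem x := by
    rw [G.t_unit]
    exact h x.2

variable (G)

/-- The category `Ĝ` of sections of a topological étale groupoid over `X`. -/
def sections : OpenCat X where
  Hom U V := G.Sect U V
  id U := Sect.incl G (le_refl U)
  comp g f := g.comp f
  id_comp f := by
    apply Sect.ext
    funext x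
    exact G.unit_comp (f.toFun x)
  comp_id {U V} f := by
    apply Sect.ext
    funext x
    have h1 : (Sect.incl G (le_refl U)).target x = x := Subtype.ext (G.t_unit x)
    refine (G.comp_congr (congrArg f.toFun h1) (?_ : _ = G.unit (G.s (f.toFun x))) _).trans
      (G.comp_unit (f.toFun x))
    rw [f.s_apply]
    rfl
  assoc h g f := by
    apply Sect.ext
    funext x
    have h1 : (g.comp f).target x = g.target (f.target x) := Subtype.ext (G.t_comp _ _ _)
    refine (G.assoc _ _ _ (h.s_apply _) (g.s_apply _)).trans ?_
    exact G.comp_congr (congrArg h.toFun h1.symm) rfl _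
  incl h := Sect.incl G h
  incl_refl _ := rfl
  incl_trans {U V W} h k := by
    apply Sect.ext
    funext x
    have h1 : (Sect.incl G h).target x = ⟨x, h x.2⟩ := Subtype.ext (G.t_unit x)
    symm
    refine (G.comp_congr (?_ : _ = G.unit (G.t (G.unit x))) rfl _).trans (G.unit_comp _)
    rw [h1]
    exact congrArg G.unit (G.t_unit x).symm

/-- An isomorphism of topological groupoids, over the identity of `X`, from `G` to `C⋆`, where the
arrows of `C⋆` carry the topology of the étale space of `C(-, X)`. -/
structure StarIso (C : OpenCat X) where
  toHomeomorph : G.Arr ≃ₜ C.StarArrow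
  src_eq : ∀ g, (toHomeomorph g).src = G.s g
  tgt_eq : ∀ g, (toHomeomorph g).tgt = G.t g
  map_comp : ∀ (x y z : X) (b : C.StarHom y z) (a : C.StarHom x y) (g f : G.Arr)
    (h : G.s g = G.t f), toHomeomorph g = ⟨y, z, b⟩ → toHomeomorph f = ⟨x, y, a⟩ →
      toHomeomorph (G.comp g f h) = ⟨x, z, OpenCat.starComp b a⟩

/-- The composition map, extended to all pairs of arrows by the first projection. Only its values
on composable pairs are ever used. -/
noncomputable def compExt (p : G.Arr × G.Arr) : G.Arr :=
  open Classical in if h : G.s p.1 = G.t p.2 then G.comp p.1 p.2 h else p.1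

end EtaleGroupoid

/-- An étale Lie groupoid over the smooth `n`-manifold `X`: the arrows form a smooth `n`-manifold,
the source and target maps are local diffeomorphisms, and all structure maps are smooth. As usual
for Lie groupoids, the manifold of arrows need be neither Hausdorff nor second countable. -/
structure EtaleLieGroupoid (n : ℕ) (X : Type u) [TopologicalSpace X]
    [ChartedSpace (EuclideanSpace ℝ (Fin n)) X] extends EtaleGroupoid X where
  [charted : ChartedSpace (EuclideanSpace ℝ (Fin n)) Arr]
  [isManifold : IsManifold (𝓡 n) ∞ Arr]
  isLocalDiffeomorph_s : IsLocalDiffeomorph (𝓡 n) (𝓡 n) ∞ s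
  isLocalDiffeomorph_t : IsLocalDiffeomorph (𝓡 n) (𝓡 n) ∞ t
  contMDiff_unit : ContMDiff (𝓡 n) (𝓡 n) ∞ unit
  contMDiff_inv : ContMDiff (𝓡 n) (𝓡 n) ∞ inv
  contMDiffOn_comp : ContMDiffOn ((𝓡 n).prod (𝓡 n)) (𝓡 n) ∞ toEtaleGroupoid.compExt
    {p | s p.1 = t p.2}

attribute [instance] EtaleLieGroupoid.charted EtaleLieGroupoid.isManifold

namespace EtaleLieGroupoid

variable {n : ℕ} {X : Type u} [TopologicalSpace X] [ChartedSpace (EuclideanSpace ℝ (Fin n)) X]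

/-- An isomorphism of Lie groupoids which is the identity on the manifold `X` of objects. -/
structure Iso (G G' : EtaleLieGroupoid n X) where
  toDiffeo : Diffeomorph (𝓡 n) (𝓡 n) G.Arr G'.Arr ∞
  s_map : ∀ g, G'.s (toDiffeo g) = G.s g
  t_map : ∀ g, G'.t (toDiffeo g) = G.t g
  map_comp : ∀ (g f : G.Arr) (h : G.s g = G.t f), toDiffeo (G.comp g f h) =
    G'.comp (toDiffeo g) (toDiffeo f) ((s_map g).trans (h.trans (t_map f).symm))

noncomputable def Iso.refl (G : EtaleLieGroupoid n X) : Iso G G where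
  toDiffeo := Diffeomorph.refl _ _ _
  s_map _ := rfl
  t_map _ := rfl
  map_comp _ _ _ := rfl

noncomputable def Iso.symm {G G' : EtaleLieGroupoid n X} (e : Iso G G') : Iso G' G where
  toDiffeo := e.toDiffeo.symm
  s_map g := by rw [← e.s_map, e.toDiffeo.apply_symm_apply]
  t_map g := by rw [← e.t_map, e.toDiffeo.apply_symm_apply]
  map_comp g f h := by
    apply e.toDiffeo.injective
    refine (e.toDiffeo.apply_symm_apply _).trans (Eq.symm ((e.map_comp _ _ _).trans (Eq.symm ?_)))
    exact G'.comp_congr (e.toDiffeo.apply_symm_apply g).symm (e.toDiffeo.apply_symm_apply f).symm h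

noncomputable def Iso.trans {G G' G'' : EtaleLieGroupoid n X} (e : Iso G G') (e' : Iso G' G'') : Iso G G'' where
  toDiffeo := e.toDiffeo.trans e'.toDiffeo
  s_map g := (e'.s_map _).trans (e.s_map g)
  t_map g := (e'.t_map _).trans (e.t_map g)
  map_comp g f h := by
    change e'.toDiffeo (e.toDiffeo _) = _
    rw [e.map_comp, e'.map_comp]
    rfl

/-- Isomorphism of étale Lie groupoids over `X`. -/
instance isoSetoid (n : ℕ) (X : Type u) [TopologicalSpace X]
    [ChartedSpace (EuclideanSpace ℝ (Fin n)) X] : Setoid (EtaleLieGroupoid n X) where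
  r G G' := Nonempty (Iso G G')
  iseqv :=
    { refl := fun G => ⟨Iso.refl G⟩
      symm := fun ⟨e⟩ => ⟨e.symm⟩
      trans := fun ⟨e⟩ ⟨e'⟩ => ⟨e.trans e'⟩ }

end EtaleLieGroupoid

/-- A smooth pseudogroup sheaf on the smooth `n`-manifold `X`: all underlying maps are smooth. -/
structure SmoothPseudogroupSheaf (n : ℕ) (X : Type u) [TopologicalSpace X]
    [ChartedSpace (EuclideanSpace ℝ (Fin n)) X] extends OpenCat X where
  isPseudogroupSheaf : toOpenCat.IsPseudogroupSheaf
  smooth : ∀ {U V : Opens X} (f : Hom U V),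
    ContMDiff (𝓡 n) (𝓡 n) ∞ (OpenCat.underlying isPseudogroupSheaf f)

/-- Isomorphism of smooth pseudogroup sheaves on `X`. -/
instance SmoothPseudogroupSheaf.isoSetoid (n : ℕ) (X : Type u) [TopologicalSpace X]
    [ChartedSpace (EuclideanSpace ℝ (Fin n)) X] : Setoid (SmoothPseudogroupSheaf n X) where
  r C D := Nonempty (OpenCat.Iso C.toOpenCat D.toOpenCat)
  iseqv :=
    { refl := fun C => ⟨OpenCat.Iso.refl C.toOpenCat⟩
      symm := fun ⟨e⟩ => ⟨e.symm⟩
      trans := fun ⟨e⟩ ⟨e'⟩ => ⟨e.trans e'⟩ }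

end EtalePG

/-! A pseudogroup sheaf and an étale groupoid describe one object, by sections and by germs: this is
the correspondence between sheaves and étale spaces, enriched with composition.

In an étale groupoid `G` the source map is a local homeomorphism, so every arrow lies on a local
section, and two sections that agree at a point agree near it (`eval_injective`). A germ in the
stalk of `Ĝ(-, V)` is therefore just an arrow with given source and with target in `V`. Since `X` is
T₁, a compatible family over all `V ∋ y` has target exactly `y`. This gives the axioms for `Ĝ`
(`sections_isPseudogroupSheaf`) and `G ≅ Ĝ⋆` (`starIsoSections`).

Conversely, for a pseudogroup sheaf `C` the decomposition axiom turns `f ∈ C(U, V)` into a section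
`x ↦ f_x` of the source map of `C⋆`, whose image is open and homeomorphic to `U`. Inversion and
composition are continuous because an equality of germs holds on a neighbourhood. A continuous
section agrees locally with morphisms of `C`, and the sheaf axiom glues these; so `G ≅ C⋆` gives `C
≅ Ĝ` (`isoSections`). Hence `Ĝ ≅ C` and `G ≅ C⋆` are equivalent.

The smooth structure adds no choice. The arrows of `C⋆` receive the one pulled back along the source
map, and a continuous map is smooth once its composite with a local diffeomorphism is. All structure
maps then become smooth as soon as the target map is, and that follows from smoothness of the
underlying maps `f̄`. For the same reason a homeomorphism of arrows over `X` is a diffeomorphism, so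
topological isomorphisms suffice. -/

namespace EtalePG

/-! ### Local homeomorphisms and local diffeomorphisms -/

section Pullback

variable {H M N : Type*} [TopologicalSpace H] [TopologicalSpace M] [TopologicalSpace N]
  [ChartedSpace H N] {f : M → N}

/-- The chart at `a` of the charted space pulled back along a local homeomorphism `f`. -/
noncomputable def pullbackChart (H : Type*) [TopologicalSpace H] [ChartedSpace H N]
    (hf : IsLocalHomeomorph f) (a : M) : OpenPartialHomeomorph M H :=
  (hf.localInverseAt a).symm ≫ₕ chartAt H (f a)

/-- The charted space structure pulled back along a local homeomorphism. -/
@[reducible]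
noncomputable def pullbackChartedSpace (H : Type*) [TopologicalSpace H] [ChartedSpace H N]
    (hf : IsLocalHomeomorph f) : ChartedSpace H M where
  atlas := range (pullbackChart H hf)
  chartAt := pullbackChart H hf
  mem_chart_source a := by
    simp [pullbackChart]
  chart_mem_atlas a := mem_range_self a

/-- Since `f` composed with a local inverse is the identity, a transition map upstairs is the
restriction to a smaller open set of a transition map of `N`. -/
theorem hasGroupoid_pullbackChartedSpace (G : StructureGroupoid H) [ClosedUnderRestriction G]
    [HasGroupoid N G] (hf : IsLocalHomeomorph f) :
    letI := pullbackChartedSpace H hf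
    HasGroupoid M G := by
  let := pullbackChartedSpace H hf
  refine ⟨?_⟩
  rintro _ _ ⟨a, rfl⟩ ⟨b, rfl⟩
  have h1 := G.compatible (chart_mem_atlas H (f a)) (chart_mem_atlas H (f b))
  have hS := ((pullbackChart H hf a).symm ≫ₕ pullbackChart H hf b).open_source
  refine G.mem_of_eqOnSource (closedUnderRestriction' h1 hS) ?_
  have key : ∀ z ∈ (hf.localInverseAt a).source, f ((hf.localInverseAt a) z) = z := fun z hz =>
    hf.apply_localInverseAt_of_mem hz
  constructor
  · rw [OpenPartialHomeomorph.restr_source, hS.interior_eq]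
    ext z
    simp only [pullbackChart, mem_inter_iff, OpenPartialHomeomorph.trans_source,
      OpenPartialHomeomorph.symm_source, mem_preimage, OpenPartialHomeomorph.trans_symm_eq_symm_trans_symm,
      OpenPartialHomeomorph.symm_symm, IsLocalHomeomorph.localInverseAt_symm,
      OpenPartialHomeomorph.coe_trans, Function.comp_apply]
    constructor
    · rintro h
      refine ⟨⟨h.1.1, ?_⟩, h⟩
      have := h.2.2
      rwa [key _ h.1.2] at this
    · exact fun h => h.2
  · intro z hz
    simp only [pullbackChart, mem_inter_iff, OpenPartialHomeomorph.trans_source,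
      OpenPartialHomeomorph.symm_source, mem_preimage, OpenPartialHomeomorph.trans_symm_eq_symm_trans_symm,
      OpenPartialHomeomorph.symm_symm, IsLocalHomeomorph.localInverseAt_symm,
      OpenPartialHomeomorph.coe_trans, Function.comp_apply] at hz ⊢
    rw [key _ hz.1.2]
    rfl

end Pullback

/-! ### Pulled-back smooth structures and lifts through local diffeomorphisms -/

section Manifold

variable {𝕜 E H M N P E' H' : Type*} [NontriviallyNormedField 𝕜] [NormedAddCommGroup E]
  [NormedSpace 𝕜 E] [TopologicalSpace H] {I : ModelWithCorners 𝕜 E H} {m : WithTop ℕ∞}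
  [TopologicalSpace M] [TopologicalSpace N] [ChartedSpace H N]
  [NormedAddCommGroup E'] [NormedSpace 𝕜 E'] [TopologicalSpace H'] {J : ModelWithCorners 𝕜 E' H'}
  [TopologicalSpace P] [ChartedSpace H' P] {f : M → N}

theorem isManifold_pullbackChartedSpace [IsManifold I m N] (hf : IsLocalHomeomorph f) :
    letI := pullbackChartedSpace H hf
    IsManifold I m M :=
  letI := pullbackChartedSpace H hf
  { hasGroupoid_pullbackChartedSpace (contDiffGroupoid m I) hf with }

/-- Read in the chart at `a` and the chart at `f a`, the map `f` is the identity; the local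
diffeomorphism is one chart followed by the inverse of the other. -/
theorem isLocalDiffeomorph_pullbackChartedSpace [IsManifold I m N] (hf : IsLocalHomeomorph f) :
    letI := pullbackChartedSpace H hf
    IsLocalDiffeomorph I I m f := by
  let := pullbackChartedSpace H hf
  have : IsManifold I m M := isManifold_pullbackChartedSpace hf
  intro a
  let e : OpenPartialHomeomorph M N := chartAt H a ≫ₕ (chartAt H (f a)).symm
  refine ⟨{ toPartialEquiv := e.toPartialEquiv
            open_source := e.open_source
            open_target := e.open_target
            contMDiffOn_toFun := ?_
            contMDiffOn_invFun := ?_ }, ?_, ?_⟩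
  · exact contMDiffOn_chart_symm.comp (contMDiffOn_chart.mono inter_subset_left)
      inter_subset_right
  · exact contMDiffOn_chart_symm.comp (contMDiffOn_chart.mono inter_subset_left)
      inter_subset_right
  · refine ⟨mem_chart_source H a, ?_⟩
    exact (chartAt H (f a)).map_source (by simp)
  · intro z hz
    have hz' : f z ∈ (chartAt H (f a)).source := by
      have : z ∈ (pullbackChart H hf a).source := hz.1
      simpa [pullbackChart] using this.2
    have he : e z = f z := by
      change (chartAt H (f a)).symm ((chartAt H (f a)) ((hf.localInverseAt a).symm z)) = f z
      rw [IsLocalHomeomorph.localInverseAt_symm, (chartAt H (f a)).left_inv hz']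
    exact he.symm

variable [ChartedSpace H M]

/-- A continuous lift of a `C^m` map through a local diffeomorphism is `C^m`. -/
theorem contMDiffWithinAt_of_comp_isLocalDiffeomorph (hf : IsLocalDiffeomorph I I m f)
    {h : P → M} {S : Set P} {p : P} (hc : ContinuousWithinAt h S p)
    (hs : ContMDiffWithinAt J I m (f ∘ h) S p) : ContMDiffWithinAt J I m h S p := by
  obtain ⟨Φ, hΦ, hΦf⟩ := hf (h p)
  -- Near `p`, `h` equals `Φ⁻¹ ∘ (f ∘ h)`; continuity of `h` keeps its values in the source of `Φ`.
  have h1 : ContMDiffWithinAt J I m (Φ.symm ∘ (f ∘ h)) S p := by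
    refine ContMDiffAt.comp_contMDiffWithinAt p ?_ hs
    refine Φ.contMDiffOn_invFun.contMDiffAt (Φ.open_target.mem_nhds ?_)
    change f (h p) ∈ Φ.target
    rw [hΦf hΦ]
    exact Φ.map_source hΦ
  refine h1.congr_of_eventuallyEq ?_ ?_
  · filter_upwards [hc (Φ.open_source.mem_nhds hΦ)] with q hq
    change h q = Φ.toPartialEquiv.symm (f (h q))
    rw [hΦf hq]
    exact (Φ.left_inv hq).symm
  · change h p = Φ.toPartialEquiv.symm (f (h p))
    rw [hΦf hΦ]
    exact (Φ.left_inv hΦ).symm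

theorem contMDiff_of_comp_isLocalDiffeomorph (hf : IsLocalDiffeomorph I I m f)
    {h : P → M} (hc : Continuous h) (hs : ContMDiff J I m (f ∘ h)) : ContMDiff J I m h :=
  fun p => contMDiffWithinAt_of_comp_isLocalDiffeomorph hf hc.continuousWithinAt (hs p)

end Manifold


namespace OpenCat

/-! ### Arrows of `C⋆` represented by a morphism of `C` -/

section Basic

variable {X : Type u} [TopologicalSpace X] {C : OpenCat X}

theorem exists_germ_eq {x : X} {V : Opens X} (c : C.Stalk x V) :
    ∃ (U : Opens X) (hx : x ∈ U) (f : C.Hom U V), C.germ x hx f = c :=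
  Quotient.inductionOn c fun f => ⟨f.1.1, f.1.2, f.2, rfl⟩

theorem germ_eq_iff {x : X} {U U' V : Opens X} (hx : x ∈ U) (hx' : x ∈ U') (f : C.Hom U V)
    (f' : C.Hom U' V) : C.germ x hx f = C.germ x hx' f' ↔
      ∃ (W : Opens X) (_ : x ∈ W) (h : W ≤ U) (k : W ≤ U'), C.restrict h f = C.restrict k f' :=
  ⟨fun h => Quotient.exact h, fun h => Quotient.sound h⟩

/-- The set of arrows of `C⋆` which are germs of `f ∈ C(U, V)`. -/
def germArrows {U V : Opens X} (f : C.Hom U V) : Set C.StarArrow :=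
  {a | ∃ (h : a.src ∈ U) (k : a.tgt ∈ V), a.hom.proj V k = C.germ a.src h f}

theorem germArrows_top {U : Opens X} (f : C.Hom U ⊤) : germArrows f = C.basicArrows f := by
  ext a
  exact ⟨fun ⟨h, _, e⟩ => ⟨h, e⟩, fun ⟨h, e⟩ => ⟨h, trivial, e⟩⟩

/-- With `exists_restrict_eq` below, this is how an equality of germs at one point is transported to
all nearby arrows. -/
theorem mem_germArrows_of_restrict_eq {U U' V W : Opens X} {f : C.Hom U V} {f' : C.Hom U' V}
    (h : W ≤ U) (k : W ≤ U') (e : C.restrict h f = C.restrict k f') {a : C.StarArrow}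
    (ha : a ∈ germArrows f) (hW : a.src ∈ W) : a ∈ germArrows f' := by
  obtain ⟨_, h2, h3⟩ := ha
  exact ⟨k hW, h2, h3.trans ((germ_eq_iff _ _ _ _).2 ⟨W, hW, h, k, e⟩)⟩

theorem exists_restrict_eq {U U' V : Opens X} {f : C.Hom U V} {f' : C.Hom U' V}
    {a : C.StarArrow} (ha : a ∈ germArrows f) (ha' : a ∈ germArrows f') :
    ∃ (W : Opens X) (_ : a.src ∈ W) (h : W ≤ U) (k : W ≤ U'),
      C.restrict h f = C.restrict k f' := by
  obtain ⟨h1, h2, h3⟩ := ha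
  obtain ⟨h1', h2', h3'⟩ := ha'
  exact (germ_eq_iff h1 h1' f f').1 (h3.symm.trans h3')

theorem exists_mem_germArrows (a : C.StarArrow) {V : Opens X} (hV : a.tgt ∈ V) :
    ∃ (U : Opens X) (f : C.Hom U V), a ∈ germArrows f := by
  obtain ⟨U, hx, f, e⟩ := exists_germ_eq (a.hom.proj V hV)
  exact ⟨U, f, hx, hV, e.symm⟩

theorem mem_germArrows_restrict {U U' V : Opens X} (h : U' ≤ U) {f : C.Hom U V}
    {a : C.StarArrow} (ha : a ∈ germArrows f) (hU' : a.src ∈ U') :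
    a ∈ germArrows (C.restrict h f) :=
  mem_germArrows_of_restrict_eq h le_rfl (C.restrict_self _).symm ha hU'

theorem mem_germArrows_of_mem_restrict {U U' V : Opens X} (h : U' ≤ U) {f : C.Hom U V}
    {a : C.StarArrow} (ha : a ∈ germArrows (C.restrict h f)) : a ∈ germArrows f :=
  mem_germArrows_of_restrict_eq le_rfl h (C.restrict_self _) ha ha.1

theorem mem_germArrows_incl_comp {U V V' : Opens X} (h : V ≤ V') {f : C.Hom U V}
    {a : C.StarArrow} (ha : a ∈ germArrows f) : a ∈ germArrows (C.comp (C.incl h) f) := by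
  obtain ⟨h1, h2, h3⟩ := ha
  exact ⟨h1, h h2, by rw [← a.hom.compat h h2, h3, push_germ]⟩

/-! ### Composition on the total set of arrows of `C⋆` -/

namespace StarArrow

/-- The identity arrow of `C⋆` at `x`. -/
def unit (C : OpenCat X) (x : X) : C.StarArrow := ⟨x, x, starId C x⟩

/-- Composition of composable arrows of `C⋆`. -/
def comp : (b a : C.StarArrow) → b.src = a.tgt → C.StarArrow
  | ⟨_, z, b⟩, ⟨x, _, a⟩, rfl => ⟨x, z, starComp b a⟩

theorem src_comp : ∀ (b a : C.StarArrow) (h : b.src = a.tgt), (comp b a h).src = a.src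
  | ⟨_, _, _⟩, ⟨_, _, _⟩, rfl => rfl

theorem tgt_comp : ∀ (b a : C.StarArrow) (h : b.src = a.tgt), (comp b a h).tgt = b.tgt
  | ⟨_, _, _⟩, ⟨_, _, _⟩, rfl => rfl

theorem comp_unit : ∀ a : C.StarArrow, comp a (unit C a.src) rfl = a
  | ⟨x, y, a⟩ => congrArg (StarArrow.mk x y)
      -- The left and right unit laws trade places, as composition in `Category` is written in
      -- diagrammatic order.
      (Category.id_comp (obj := Star C) (X := x) (Y := y) a)

theorem unit_comp : ∀ a : C.StarArrow, comp (unit C a.tgt) a rfl = a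
  | ⟨x, y, a⟩ => congrArg (StarArrow.mk x y)
      (Category.comp_id (obj := Star C) (X := x) (Y := y) a)

theorem comp_assoc (c b a : C.StarArrow) (h₁ : c.src = b.tgt) (h₂ : b.src = a.tgt) :
    comp (comp c b h₁) a ((src_comp _ _ _).trans h₂) =
      comp c (comp b a h₂) (h₁.trans (tgt_comp _ _ _).symm) := by
  obtain ⟨z, w, c⟩ := c
  obtain ⟨y, z', b⟩ := b
  obtain ⟨x, y', a⟩ := a
  obtain rfl : z = z' := h₁
  obtain rfl : y = y' := h₂
  exact congrArg (StarArrow.mk x w)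
    (Category.assoc (obj := Star C) (W := x) (X := y) (Y := z) (Z := w) a b c).symm

theorem comp_mem_germArrows {U V W : Opens X} {g : C.Hom V W} {f : C.Hom U V} :
    ∀ {b a : C.StarArrow} (h : b.src = a.tgt), b ∈ germArrows g → a ∈ germArrows f →
      comp b a h ∈ germArrows (C.comp g f)
  | ⟨_, _, b⟩, ⟨_, _, a⟩, rfl, ⟨_, k1, e1⟩, ⟨h2, k2, e2⟩ => by
    refine ⟨h2, k1, ?_⟩
    change germComp (b.proj W k1) a = _
    change b.proj W k1 = _ at e1
    change a.proj V k2 = _ at e2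
    rw [e1, germComp_germ, e2, push_germ]
    rfl

theorem unit_mem_germArrows_id {V : Opens X} {x : X} (hx : x ∈ V) :
    unit C x ∈ germArrows (C.id V) := ⟨hx, hx, rfl⟩

theorem unit_mem_germArrows_incl {U V : Opens X} (h : U ≤ V) {x : X} (hx : x ∈ U) :
    unit C x ∈ germArrows (C.incl h) := by
  refine mem_germArrows_of_restrict_eq h le_rfl ?_ (unit_mem_germArrows_id (h hx)) hx
  rw [restrict_self, restrict, C.id_comp]

end StarArrow

theorem isOpen_germArrows_top {U : Opens X} (f : C.Hom U ⊤) : IsOpen (germArrows f) :=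
  isOpen_generateFrom_of_mem ⟨U, f, germArrows_top f⟩

theorem continuous_starArrow_iff {Y : Type*} [TopologicalSpace Y] {F : Y → C.StarArrow} :
    Continuous F ↔ ∀ (U : Opens X) (f : C.Hom U ⊤), IsOpen (F ⁻¹' germArrows f) := by
  refine continuous_generateFrom_iff.trans ⟨fun h U f => h _ ⟨U, f, germArrows_top f⟩, ?_⟩
  rintro h _ ⟨U, f, rfl⟩
  rw [← germArrows_top]
  exact h U f

theorem StarArrow.continuous_src : Continuous (StarArrow.src : C.StarArrow → X) := by
  refine continuous_def.2 fun W hW => isOpen_iff_forall_mem_open.2 fun a ha => ?_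
  obtain ⟨U, f, haf⟩ := exists_mem_germArrows a (V := ⊤) trivial
  refine ⟨germArrows (C.restrict (U' := U ⊓ ⟨W, hW⟩) inf_le_left f), fun b hb => hb.1.2,
    isOpen_germArrows_top _, mem_germArrows_restrict _ haf ⟨haf.1, ha⟩⟩

theorem StarArrow.continuous_unit : Continuous (StarArrow.unit C) := by
  refine continuous_starArrow_iff.2 fun U f => isOpen_iff_forall_mem_open.2 fun x hx => ?_
  obtain ⟨W, hW, h, k, e⟩ := exists_restrict_eq
    (StarArrow.unit_mem_germArrows_id (C := C) (V := ⊤) (x := x) trivial) hx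
  exact ⟨W, fun x' hx' => mem_germArrows_of_restrict_eq h k e
    (StarArrow.unit_mem_germArrows_id trivial) hx', W.2, hW⟩

end Basic

/-! ### `C⋆` as a topological étale groupoid -/

namespace IsPseudogroupSheaf

variable {X : Type u} [TopologicalSpace X] {C : OpenCat X} (hC : C.IsPseudogroupSheaf)

include hC

/-- Injectivity in the decomposition axiom: the source and a single projection determine the arrow,
including its target. -/
theorem arrow_ext {x y y' : X} (a : C.StarHom x y) (b : C.StarHom x y') {V : Opens X}
    (hy : y ∈ V) (hy' : y' ∈ V) (e : a.proj V hy = b.proj V hy') :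
    (⟨x, y, a⟩ : C.StarArrow) = ⟨x, y', b⟩ := by
  have := (hC.decomp x V).1 (a₁ := ⟨⟨y, hy⟩, a⟩) (a₂ := ⟨⟨y', hy'⟩, b⟩) e
  exact congrArg (fun c : Σ y : V, C.StarHom x (y : X) => (⟨x, c.1, c.2⟩ : C.StarArrow)) this

theorem eq_of_mem_germArrows {U V : Opens X} {f : C.Hom U V} :
    ∀ {a b : C.StarArrow}, a ∈ germArrows f → b ∈ germArrows f → a.src = b.src → a = b
  | ⟨_, _, a⟩, ⟨_, _, b⟩, ⟨_, h2, h3⟩, ⟨_, k2, k3⟩, rfl =>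
    hC.arrow_ext a b h2 k2 (h3.trans k3.symm)

/-- The arrow `f_x` of `C⋆`, for `f ∈ C(U, V)` and `x ∈ U`. -/
noncomputable def arrow {U V : Opens X} (f : C.Hom U V) (x : U) :
    C.StarArrow :=
  ⟨x, _, ((Equiv.ofBijective _ (hC.decomp x V)).symm (C.germ (x : X) x.2 f)).2⟩

theorem src_arrow {U V : Opens X} (f : C.Hom U V) (x : U) : (hC.arrow f x).src = x := rfl

theorem arrow_mem {U V : Opens X} (f : C.Hom U V) (x : U) : hC.arrow f x ∈ germArrows f :=
  ⟨x.2, ((Equiv.ofBijective _ (hC.decomp x V)).symm (C.germ (x : X) x.2 f)).1.2,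
    (Equiv.ofBijective _ (hC.decomp x V)).apply_symm_apply (C.germ (x : X) x.2 f)⟩

theorem eq_arrow {U V : Opens X} {f : C.Hom U V} {a : C.StarArrow} (ha : a ∈ germArrows f) :
    a = hC.arrow f ⟨a.src, ha.1⟩ :=
  hC.eq_of_mem_germArrows ha (hC.arrow_mem _ _) rfl

/-- The topology is generated by morphisms into `X` only; this lets germs of morphisms into any `V`
be used as open sets as well. -/
theorem germArrows_incl_comp {U V V' : Opens X} (h : V ≤ V') (f : C.Hom U V) :
    germArrows (C.comp (C.incl h) f) = germArrows f := by
  refine Subset.antisymm (fun a ha => ?_) fun a => mem_germArrows_incl_comp h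
  rw [hC.eq_of_mem_germArrows ha (mem_germArrows_incl_comp h (hC.arrow_mem f ⟨a.src, ha.1⟩)) rfl]
  exact hC.arrow_mem _ _

theorem isOpen_germArrows {U V : Opens X} (f : C.Hom U V) : IsOpen (germArrows f) := by
  rw [← hC.germArrows_incl_comp le_top f]
  exact isOpen_germArrows_top _

theorem continuous_arrow {U V : Opens X} (f : C.Hom U V) : Continuous (hC.arrow f) := by
  refine continuous_starArrow_iff.2 fun U' f' => isOpen_iff_forall_mem_open.2 fun x hx => ?_
  have hm : ∀ x, hC.arrow f x ∈ germArrows (C.comp (C.incl le_top) f) := fun x =>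
    mem_germArrows_incl_comp le_top (hC.arrow_mem f x)
  obtain ⟨W, hW, h, k, e⟩ := exists_restrict_eq (hm x) hx
  exact ⟨Subtype.val ⁻¹' W, fun x' hx' => mem_germArrows_of_restrict_eq h k e (hm x') hx',
    W.2.preimage continuous_subtype_val, hW⟩

/-- The source map of `C⋆` is a homeomorphism from the set of germs of `f ∈ C(U, V)` onto `U`. -/
noncomputable def germArrowsHomeomorph {U V : Opens X} (f : C.Hom U V) : germArrows f ≃ₜ U where
  toFun a := ⟨a.1.src, a.2.1⟩
  invFun x := ⟨hC.arrow f x, hC.arrow_mem f x⟩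
  left_inv a := Subtype.ext (hC.eq_arrow a.2).symm
  right_inv _ := rfl
  continuous_toFun := (StarArrow.continuous_src.comp continuous_subtype_val).subtype_mk _
  continuous_invFun := (hC.continuous_arrow f).subtype_mk _

theorem isLocalHomeomorph_src : IsLocalHomeomorph (StarArrow.src : C.StarArrow → X) := by
  refine isLocalHomeomorph_iff_isOpenEmbedding_restrict.2 fun a => ?_
  obtain ⟨U, f, haf⟩ := exists_mem_germArrows a (V := ⊤) trivial
  exact ⟨germArrows f, (hC.isOpen_germArrows f).mem_nhds haf,
    U.2.isOpenEmbedding_subtypeVal.comp (hC.germArrowsHomeomorph f).isOpenEmbedding⟩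

theorem exists_inv (a : C.StarArrow) : ∃ b : C.StarHom a.tgt a.src,
    starComp b a.hom = starId C a.src ∧ starComp a.hom b = starId C a.tgt :=
  (hC.groupoid.all_isIso (X := a.src) (Y := a.tgt) a.hom).out

/-- The inverse of an arrow of `C⋆`. -/
noncomputable def inv (a : C.StarArrow) : C.StarArrow :=
  ⟨a.tgt, a.src, (hC.exists_inv a).choose⟩

theorem inv_comp (a : C.StarArrow) :
    StarArrow.comp (hC.inv a) a rfl = StarArrow.unit C a.src :=
  congrArg (StarArrow.mk a.src a.src) (hC.exists_inv a).choose_spec.1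

theorem comp_inv (a : C.StarArrow) :
    StarArrow.comp a (hC.inv a) rfl = StarArrow.unit C a.tgt :=
  congrArg (StarArrow.mk a.tgt a.tgt) (hC.exists_inv a).choose_spec.2

theorem eq_inv {b a : C.StarArrow} (h : b.src = a.tgt)
    (e : StarArrow.comp b a h = StarArrow.unit C a.src) : b = hC.inv a := by
  have h1 := StarArrow.comp_assoc b a (hC.inv a) h rfl
  obtain ⟨y, z, b⟩ := b
  obtain rfl : y = a.tgt := h
  simp only [e, hC.comp_inv] at h1
  exact ((StarArrow.comp_unit (⟨a.tgt, z, b⟩ : C.StarArrow)).symm.trans h1.symm).trans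
    (StarArrow.unit_comp (hC.inv a))

/-- Let `h` represent the inverse of `a` and `f` represent `a`, with codomain the domain of `h`.
Then `h ∘ f` is the identity near the source of `a`, so for `a'` near `a` the germ of `h` at the
target of `a'` is a left inverse of `a'`, hence its inverse. -/
theorem continuous_inv : Continuous hC.inv := by
  refine continuous_starArrow_iff.2 fun V h => isOpen_iff_forall_mem_open.2 fun a ha => ?_
  obtain ⟨U, f, haf⟩ := exists_mem_germArrows a (V := V) ha.1
  have h1 : StarArrow.unit C a.src ∈ germArrows (C.comp h f) := by
    rw [← hC.inv_comp a]
    exact StarArrow.comp_mem_germArrows _ ha haf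
  obtain ⟨W, hW, k, k', e⟩ := exists_restrict_eq h1
    (StarArrow.unit_mem_germArrows_id (C := C) (V := ⊤) trivial)
  refine ⟨germArrows f ∩ StarArrow.src ⁻¹' W, ?_,
    (hC.isOpen_germArrows f).inter (W.2.preimage StarArrow.continuous_src), haf, hW⟩
  rintro a' ⟨ha', hW'⟩
  have hb := hC.arrow_mem h ⟨a'.tgt, ha'.2.1⟩
  have hbe : hC.arrow h ⟨a'.tgt, ha'.2.1⟩ = hC.inv a' := by
    refine hC.eq_inv (hC.src_arrow _ _) (hC.eq_of_mem_germArrows (f := C.id ⊤) ?_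
      (StarArrow.unit_mem_germArrows_id trivial) (StarArrow.src_comp _ _ _))
    refine mem_germArrows_of_restrict_eq k k' e (StarArrow.comp_mem_germArrows _ hb ha') ?_
    rwa [StarArrow.src_comp]
  rw [mem_preimage, ← hbe]
  exact hb

theorem continuous_comp : Continuous fun p : {p : C.StarArrow × C.StarArrow // p.1.src = p.2.tgt} =>
    StarArrow.comp p.1.1 p.1.2 p.2 := by
  refine continuous_starArrow_iff.2 fun U' h => isOpen_iff_forall_mem_open.2 fun p hp => ?_
  obtain ⟨V, g, hg⟩ := exists_mem_germArrows p.1.1 (V := ⊤) trivial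
  -- The representative of the first arrow is chosen with codomain the domain `V` of `g`, so that `g
  -- ∘ f` exists in `C`.
  obtain ⟨U, f, hf⟩ := exists_mem_germArrows p.1.2 (V := V) (p.2 ▸ hg.1)
  obtain ⟨W, hW, k, k', e⟩ := exists_restrict_eq (StarArrow.comp_mem_germArrows p.2 hg hf) hp
  rw [StarArrow.src_comp] at hW
  refine ⟨{q | q.1.1 ∈ germArrows g ∧ q.1.2 ∈ germArrows f ∧ q.1.2.src ∈ W}, ?_, ?_,
    hg, hf, hW⟩
  · rintro q ⟨h1, h2, h3⟩
    refine mem_germArrows_of_restrict_eq k k' e (StarArrow.comp_mem_germArrows q.2 h1 h2) ?_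
    rwa [StarArrow.src_comp]
  · have c1 : Continuous fun q : {p : C.StarArrow × C.StarArrow // p.1.src = p.2.tgt} => q.1.1 :=
      continuous_fst.comp continuous_subtype_val
    have c2 : Continuous fun q : {p : C.StarArrow × C.StarArrow // p.1.src = p.2.tgt} => q.1.2 :=
      continuous_snd.comp continuous_subtype_val
    exact ((hC.isOpen_germArrows g).preimage c1).inter (((hC.isOpen_germArrows f).preimage c2).inter
      (W.2.preimage (StarArrow.continuous_src.comp c2)))

theorem inv_inv (a : C.StarArrow) : hC.inv (hC.inv a) = a :=
  (hC.eq_inv rfl (hC.comp_inv a)).symm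

/-- The inversion of `C⋆` as a homeomorphism. -/
noncomputable def invHomeomorph : C.StarArrow ≃ₜ C.StarArrow where
  toFun := hC.inv
  invFun := hC.inv
  left_inv := hC.inv_inv
  right_inv := hC.inv_inv
  continuous_toFun := hC.continuous_inv
  continuous_invFun := hC.continuous_inv

/-- The topological étale groupoid `C⋆`. -/
noncomputable def starGroupoid : EtaleGroupoid X where
  Arr := C.StarArrow
  s := StarArrow.src
  t := StarArrow.tgt
  unit := StarArrow.unit C
  inv := hC.inv
  comp := StarArrow.comp
  s_unit _ := rfl
  t_unit _ := rfl
  s_inv _ := rfl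
  t_inv _ := rfl
  s_comp := StarArrow.src_comp
  t_comp := StarArrow.tgt_comp
  comp_unit := StarArrow.comp_unit
  unit_comp := StarArrow.unit_comp
  assoc := StarArrow.comp_assoc
  inv_comp := hC.inv_comp
  comp_inv := hC.comp_inv
  continuous_unit := StarArrow.continuous_unit
  continuous_inv := hC.continuous_inv
  continuous_comp := hC.continuous_comp
  isLocalHomeomorph_s := hC.isLocalHomeomorph_src
  isLocalHomeomorph_t := hC.isLocalHomeomorph_src.comp hC.invHomeomorph.isLocalHomeomorph

end IsPseudogroupSheaf

end OpenCat


/-! ### The pseudogroup sheaf of sections of an étale groupoid -/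

namespace EtaleGroupoid

variable {X : Type u} [TopologicalSpace X] {G : EtaleGroupoid X}

/-- The images of local sections of a local homeomorphism form a basis of its topology. -/
theorem exists_local_section (g : G.Arr) {O : Set G.Arr} (hO : IsOpen O) (hg : g ∈ O) :
    ∃ (U : Opens X) (hx : G.s g ∈ U) (f : U → G.Arr), Continuous f ∧ (∀ x, G.s (f x) = x) ∧
      f ⟨G.s g, hx⟩ = g ∧ ∀ x, f x ∈ O := by
  obtain ⟨_, ⟨U, hU, f, hf, rfl⟩, ⟨x, hx⟩, hfO⟩ :=
    G.isLocalHomeomorph_s.isTopologicalBasis.exists_subset_of_mem_open hg hO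
  have hf' : ∀ x, G.s (f x) = x := fun x => congrFun hf x
  have hsg : G.s g = x := by rw [← hx, hf']
  exact ⟨⟨U, hU⟩, hsg ▸ x.2, f, f.continuous, hf', (congrArg f (Subtype.ext hsg)).trans hx,
    fun y => hfO ⟨y, rfl⟩⟩

theorem exists_sect (g : G.Arr) {V : Opens X} (hg : G.t g ∈ V) :
    ∃ (U : Opens X) (hx : G.s g ∈ U) (f : G.Sect U V), f.toFun ⟨G.s g, hx⟩ = g := by
  obtain ⟨U, hx, f, h1, h2, h3, h4⟩ :=
    exists_local_section g (V.2.preimage G.isLocalHomeomorph_t.continuous) hg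
  exact ⟨U, hx, ⟨f, h1, h2, h4⟩, h3⟩

theorem Sect.isOpen_range {U V : Opens X} (f : G.Sect U V) : IsOpen (range f.toFun) := by
  have h : G.s ∘ f.toFun = Subtype.val := funext f.s_apply
  exact (G.isLocalHomeomorph_s.isOpenEmbedding_of_comp
    (h ▸ U.2.isOpenEmbedding_subtypeVal) f.continuous).isOpen_range

theorem Sect.apply_eq_of_mem_range {U V : Opens X} (f : G.Sect U V) {g : G.Arr}
    (hg : g ∈ range f.toFun) (hU : G.s g ∈ U) : f.toFun ⟨G.s g, hU⟩ = g := by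
  obtain ⟨y, rfl⟩ := hg
  exact congrArg f.toFun (Subtype.ext (f.s_apply y))

theorem restrict_toFun {U U' V : Opens X} (h : U' ≤ U) (f : G.Sect U V) (x : U') :
    Sect.toFun (G.sections.restrict h f) x = f.toFun ⟨x, h x.2⟩ := by
  have h1 : (Sect.incl G h).target x = ⟨x, h x.2⟩ := Subtype.ext (G.t_unit x)
  refine (G.comp_congr (congrArg f.toFun h1)
    (?_ : _ = G.unit (G.s (f.toFun ⟨x, h x.2⟩))) _).trans (G.comp_unit _)
  rw [f.s_apply]
  rfl

/-- The value at `x` of a germ of sections. -/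
def eval {x : X} {V : Opens X} : G.sections.Stalk x V → G.Arr :=
  Quotient.lift (fun f => Sect.toFun f.2 ⟨x, f.1.2⟩) (by
    rintro ⟨⟨U, hU⟩, f⟩ ⟨⟨U', hU'⟩, f'⟩ ⟨W, hx, h, k, e⟩
    have := congrArg (fun l : G.Sect W V => l.toFun ⟨x, hx⟩) e
    exact ((restrict_toFun h f ⟨x, hx⟩).symm.trans this).trans (restrict_toFun k f' ⟨x, hx⟩))

theorem eval_germ {x : X} {U V : Opens X} (hx : x ∈ U) (f : G.Sect U V) :
    eval (G.sections.germ x hx f) = f.toFun ⟨x, hx⟩ := rfl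

theorem s_eval {x : X} {V : Opens X} (c : G.sections.Stalk x V) : G.s (eval c) = x :=
  Quotient.inductionOn c fun f => Sect.s_apply f.2 _

theorem t_eval_mem {x : X} {V : Opens X} (c : G.sections.Stalk x V) : G.t (eval c) ∈ V :=
  Quotient.inductionOn c fun f => Sect.t_mem f.2 _

/-- Images of sections are open and the source map is open, so two sections that meet over `x`
coincide on the open set over which their images meet. No Hausdorff condition enters. -/
theorem eval_injective {x : X} {V : Opens X} :
    Function.Injective (eval : G.sections.Stalk x V → G.Arr) := by
  intro c c'
  refine Quotient.inductionOn₂ c c' ?_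
  rintro ⟨⟨U, hU⟩, f⟩ ⟨⟨U', hU'⟩, f'⟩ e
  change Sect.toFun f ⟨x, hU⟩ = Sect.toFun f' ⟨x, hU'⟩ at e
  have hS : IsOpen (G.s '' (range (Sect.toFun f) ∩ range (Sect.toFun f'))) :=
    G.isLocalHomeomorph_s.isOpenMap _ ((Sect.isOpen_range f).inter (Sect.isOpen_range f'))
  have hW : ∀ y ∈ G.s '' (range (Sect.toFun f) ∩ range (Sect.toFun f')),
      ∃ (h : y ∈ U) (k : y ∈ U'), Sect.toFun f ⟨y, h⟩ = Sect.toFun f' ⟨y, k⟩ := by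
    rintro _ ⟨g, ⟨hg, hg'⟩, rfl⟩
    have h : G.s g ∈ U := by
      obtain ⟨z, rfl⟩ := hg
      exact (Sect.s_apply f z).symm ▸ z.2
    have k : G.s g ∈ U' := by
      obtain ⟨z, rfl⟩ := hg'
      exact (Sect.s_apply f' z).symm ▸ z.2
    exact ⟨h, k, (Sect.apply_eq_of_mem_range f hg h).trans
      (Sect.apply_eq_of_mem_range f' hg' k).symm⟩
  refine (OpenCat.germ_eq_iff hU hU' f f').2 ⟨⟨_, hS⟩, ⟨Sect.toFun f ⟨x, hU⟩,
    ⟨⟨_, rfl⟩, e ▸ ⟨_, rfl⟩⟩, Sect.s_apply f _⟩, fun y hy => (hW y hy).1,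
    fun y hy => (hW y hy).2.1, ?_⟩
  apply Sect.ext
  funext y
  exact ((restrict_toFun _ f y).trans (hW y y.2).2.2).trans (restrict_toFun _ f' y).symm

theorem exists_eval_eq {g : G.Arr} {V : Opens X} (hg : G.t g ∈ V) {x : X} (hx : G.s g = x) :
    ∃ c : G.sections.Stalk x V, eval c = g := by
  subst hx
  obtain ⟨U, hU, f, e⟩ := exists_sect g hg
  exact ⟨G.sections.germ _ hU f, e⟩

theorem eval_push {x : X} {V W : Opens X} (g : G.Sect V W) (c : G.sections.Stalk x V) :
    eval (G.sections.push x g c) =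
      G.comp (g.toFun ⟨G.t (eval c), t_eval_mem c⟩) (eval c) (g.s_apply _) :=
  Quotient.inductionOn c fun _ => rfl

theorem eval_push_incl {x : X} {V W : Opens X} (h : V ≤ W) (c : G.sections.Stalk x V) :
    eval (G.sections.push x (G.sections.incl h) c) = eval c :=
  (eval_push (Sect.incl G h) c).trans (G.unit_comp _)

/-- The arrow of `G` corresponding to an arrow of `Ĝ⋆`. -/
def evalHom {x y : X} (a : G.sections.StarHom x y) : G.Arr := eval (a.proj ⊤ trivial)

theorem eval_proj {x y : X} (a : G.sections.StarHom x y) {V : Opens X} (hy : y ∈ V) :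
    eval (a.proj V hy) = evalHom a := by
  rw [evalHom, ← a.compat (le_top : V ≤ ⊤) hy, eval_push_incl]

theorem s_evalHom {x y : X} (a : G.sections.StarHom x y) : G.s (evalHom a) = x := s_eval _

/-- This is where T₁ is needed: if the target differed from `y`, its complement would be an open
neighbourhood of `y` and the projection there would have its target outside it. -/
theorem t_evalHom [T1Space X] {x y : X} (a : G.sections.StarHom x y) : G.t (evalHom a) = y := by
  by_contra h
  have hy : y ∈ (⟨{G.t (evalHom a)}ᶜ, isOpen_compl_singleton⟩ : Opens X) := Ne.symm h
  exact t_eval_mem (a.proj _ hy) (congrArg G.t (eval_proj a hy))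

theorem evalHom_injective {x y : X} :
    Function.Injective (evalHom : G.sections.StarHom x y → G.Arr) := by
  intro a b e
  apply OpenCat.StarHom.ext
  funext V hV
  exact eval_injective (by rw [eval_proj, eval_proj, e])

theorem exists_evalHom_eq {g : G.Arr} {x y : X} (hx : G.s g = x) (hy : G.t g = y) :
    ∃ a : G.sections.StarHom x y, evalHom a = g := by
  subst hy
  choose c hc using fun (V : Opens X) (hV : G.t g ∈ V) => exists_eval_eq hV hx
  exact ⟨⟨c, fun h hy => eval_injective (by rw [eval_push_incl, hc, hc])⟩, hc _ _⟩

/-- Represent the germ of `b` by a section `g` near `y`; composing with it evaluates `g` at the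
target of `a`, which is `y`. -/
theorem evalHom_starComp [T1Space X] {x y z : X} (b : G.sections.StarHom y z)
    (a : G.sections.StarHom x y) : evalHom (OpenCat.starComp b a) =
      G.comp (evalHom b) (evalHom a) ((s_evalHom b).trans (t_evalHom a).symm) := by
  obtain ⟨V, hV, g, hg⟩ := OpenCat.exists_germ_eq (b.proj ⊤ trivial)
  have h1 : evalHom (OpenCat.starComp b a) = eval (G.sections.push x g (a.proj V hV)) :=
    congrArg (fun c => eval (OpenCat.germComp c a)) hg.symm
  have h2 : Sect.toFun g ⟨y, hV⟩ = evalHom b := congrArg eval hg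
  refine (h1.trans (eval_push g _)).trans (G.comp_congr ?_ (eval_proj a hV) _)
  rw [← h2]
  exact congrArg (Sect.toFun g) (Subtype.ext ((congrArg G.t (eval_proj a hV)).trans (t_evalHom a)))

theorem sections_isSheaf (V : Opens X) : (G.sections.presheaf V).IsSheaf := by
  refine TopCat.Presheaf.isSheaf_of_isSheafUniqueGluing_types _ fun ι U sf hsf => ?_
  have hcomp : ∀ (i j : ι) (x : X) (hi : x ∈ U i) (hj : x ∈ U j),
      Sect.toFun (sf i) ⟨x, hi⟩ = Sect.toFun (sf j) ⟨x, hj⟩ := by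
    intro i j x hi hj
    have := congrArg (fun l : G.Sect (U i ⊓ U j) V => l.toFun ⟨x, hi, hj⟩) (hsf i j)
    exact ((restrict_toFun inf_le_left (sf i) ⟨x, hi, hj⟩).symm.trans this).trans
      (restrict_toFun inf_le_right (sf j) ⟨x, hi, hj⟩)
  -- Each point takes its value from one chosen member of the cover; `heq` shows that the choice is
  -- immaterial, whence continuity.
  choose i hi using fun x : (iSup U : Opens X) => Opens.mem_iSup.1 x.2
  have heq : ∀ (x : (iSup U : Opens X)) (j : ι) (hj : (x : X) ∈ U j),
      Sect.toFun (sf (i x)) ⟨x, hi x⟩ = Sect.toFun (sf j) ⟨x, hj⟩ := fun x j hj =>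
    hcomp _ _ _ _ _
  let σ : G.Sect (iSup U) V :=
    { toFun := fun x => Sect.toFun (sf (i x)) ⟨x, hi x⟩
      continuous := by
        refine continuous_of_cover_nhds (s := fun j => Subtype.val ⁻¹' (U j : Set X)) (fun x =>
          ⟨i x, ((U (i x)).2.preimage continuous_subtype_val).mem_nhds (hi x)⟩) fun j => ?_
        rw [continuousOn_iff_continuous_domRestrict]
        have : Continuous fun y : ((Subtype.val ⁻¹' (U j : Set X) : Set (iSup U : Opens X))) =>
            Sect.toFun (sf j) ⟨y.1.1, y.2⟩ :=
          (Sect.continuous (sf j)).comp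
            ((continuous_subtype_val.comp continuous_subtype_val).subtype_mk _)
        exact this.congr fun y => (heq y.1 j y.2).symm
      s_apply := fun x => Sect.s_apply (sf (i x)) _
      t_mem := fun x => Sect.t_mem (sf (i x)) _ }
  refine ⟨σ, fun j => ?_, fun τ hτ => ?_⟩
  · apply Sect.ext
    funext x
    exact (restrict_toFun (le_iSup U j) σ x).trans (heq _ _ _)
  · apply Sect.ext
    funext x
    have := congrArg (fun l : G.Sect (U (i x)) V => l.toFun ⟨x, hi x⟩) (hτ (i x))
    exact (restrict_toFun (le_iSup U (i x)) τ ⟨x, hi x⟩).symm.trans this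

variable (G) in
theorem sections_isPseudogroupSheaf [T1Space X] : G.sections.IsPseudogroupSheaf where
  decomp x V := by
    constructor
    · rintro ⟨⟨y, hy⟩, a⟩ ⟨⟨y', hy'⟩, b⟩ e
      change a.proj V hy = b.proj V hy' at e
      have h : evalHom a = evalHom b :=
        (eval_proj a hy).symm.trans ((congrArg eval e).trans (eval_proj b hy'))
      obtain rfl : y = y' := (t_evalHom a).symm.trans ((congrArg G.t h).trans (t_evalHom b))
      rw [evalHom_injective h]
    · intro c
      obtain ⟨a, ha⟩ := exists_evalHom_eq (s_eval c) (rfl : G.t (eval c) = _)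
      exact ⟨⟨⟨_, t_eval_mem c⟩, a⟩, eval_injective ((eval_proj a _).trans ha)⟩
  groupoid := ⟨fun {x y} a => by
    obtain ⟨b, hb⟩ := exists_evalHom_eq (g := G.inv (evalHom a))
      ((G.s_inv _).trans (t_evalHom a)) ((G.t_inv _).trans (s_evalHom a))
    refine ⟨⟨b, evalHom_injective ?_, evalHom_injective ?_⟩⟩
    · refine (evalHom_starComp b a).trans ((G.comp_congr hb rfl _).trans ?_)
      exact (G.inv_comp _).trans (congrArg G.unit (s_evalHom a))
    · refine (evalHom_starComp a b).trans ((G.comp_congr rfl hb _).trans ?_)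
      exact (G.comp_inv _).trans (congrArg G.unit (t_evalHom a))⟩
  sheaf := sections_isSheaf

theorem underlying_sections [T1Space X] (G : EtaleGroupoid X) {U V : Opens X} (f : G.Sect U V)
    (x : U) : (OpenCat.underlying G.sections_isPseudogroupSheaf f x : X) = G.t (f.toFun x) := by
  obtain ⟨_, h2, h3⟩ := G.sections_isPseudogroupSheaf.arrow_mem f x
  have h := (eval_proj (G.sections_isPseudogroupSheaf.arrow f x).hom h2).symm.trans
    (congrArg eval h3)
  exact (t_evalHom (G.sections_isPseudogroupSheaf.arrow f x).hom).symm.trans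
    (congrArg G.t h)

/-- The arrow of `Ĝ⋆` corresponding to an arrow of `G`. -/
noncomputable def toStarArrow (g : G.Arr) : G.sections.StarArrow :=
  ⟨G.s g, G.t g, (exists_evalHom_eq (g := g) rfl rfl).choose⟩

theorem evalHom_toStarArrow (g : G.Arr) : evalHom (toStarArrow g).hom = g :=
  (exists_evalHom_eq (g := g) rfl rfl).choose_spec

theorem starArrow_ext [T1Space X] : ∀ {a b : G.sections.StarArrow},
    evalHom a.hom = evalHom b.hom → a = b
  | ⟨x, y, a⟩, ⟨x', y', b⟩, h => by
    obtain rfl : x = x' := (s_evalHom a).symm.trans ((congrArg G.s h).trans (s_evalHom b))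
    obtain rfl : y = y' := (t_evalHom a).symm.trans ((congrArg G.t h).trans (t_evalHom b))
    exact congrArg (OpenCat.StarArrow.mk x y) (evalHom_injective h)

theorem mem_germArrows_iff {U : Opens X} (f : G.Sect U ⊤) (a : G.sections.StarArrow) :
    a ∈ OpenCat.germArrows (C := G.sections) f ↔ evalHom a.hom ∈ range f.toFun := by
  constructor
  · rintro ⟨h, _, e⟩
    exact ⟨⟨a.src, h⟩, (congrArg eval e).symm⟩
  · rintro ⟨x, hx⟩
    have hs : a.src = x := by rw [← s_evalHom a.hom, ← hx, f.s_apply]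
    refine ⟨hs ▸ x.2, trivial, eval_injective ?_⟩
    rw [eval_germ]
    exact hx.symm.trans (congrArg f.toFun (Subtype.ext hs.symm))

variable (G) in
/-- The isomorphism from an étale groupoid `G` to `Ĝ⋆`. -/
noncomputable def starIsoSections [T1Space X] : G.StarIso G.sections where
  toHomeomorph :=
    { toFun := toStarArrow
      invFun := fun a => evalHom a.hom
      left_inv := evalHom_toStarArrow
      right_inv := fun _ => starArrow_ext (evalHom_toStarArrow _)
      continuous_toFun := by
        refine OpenCat.continuous_starArrow_iff.2 fun U f => ?_
        convert Sect.isOpen_range f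
        ext g
        exact (mem_germArrows_iff f _).trans (by rw [evalHom_toStarArrow])
      continuous_invFun := by
        refine continuous_def.2 fun O hO => isOpen_iff_forall_mem_open.2 fun a ha => ?_
        obtain ⟨U, hx, f, h1, h2, h3, h4⟩ := exists_local_section _ hO ha
        let σ : G.Sect U ⊤ := ⟨f, h1, h2, fun _ => trivial⟩
        refine ⟨OpenCat.germArrows (C := G.sections) σ, fun b hb => ?_,
          OpenCat.isOpen_germArrows_top (C := G.sections) σ, (mem_germArrows_iff σ a).2 ⟨_, h3⟩⟩
        obtain ⟨y, hy⟩ := (mem_germArrows_iff σ b).1 hb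
        exact mem_preimage.2 (mem_of_eq_of_mem hy.symm (h4 y)) }
  src_eq _ := rfl
  tgt_eq _ := rfl
  map_comp x y z b a g f h hg hf := by
    change toStarArrow g = _ at hg
    change toStarArrow f = _ at hf
    change toStarArrow (G.comp g f h) = _
    have hg' : g = evalHom b := by rw [← evalHom_toStarArrow g, hg]
    have hf' : f = evalHom a := by rw [← evalHom_toStarArrow f, hf]
    rw [G.comp_congr hg' hf' h, ← evalHom_starComp]
    exact starArrow_ext (evalHom_toStarArrow _)

end EtaleGroupoid


/-! ### Functoriality of `C⋆` -/

namespace OpenCat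

variable {X : Type u} [TopologicalSpace X] {C D : OpenCat X}

namespace Iso

variable (e : Iso C D)

theorem map_restrict {U U' V : Opens X} (h : U' ≤ U) (f : C.Hom U V) :
    e.toEquiv U' V (C.restrict h f) = D.restrict h (e.toEquiv U V f) := by
  rw [restrict, e.map_comp, e.map_incl, restrict]

/-- The map on germs induced by an isomorphism of categories over `X_top`. -/
def mapStalk {x : X} {V : Opens X} : C.Stalk x V → D.Stalk x V :=
  Quotient.lift (fun f => D.germ x f.1.2 (e.toEquiv _ _ f.2)) (by
    rintro f f' ⟨W, hx, h, k, q⟩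
    refine Quotient.sound ⟨W, hx, h, k, ?_⟩
    change D.restrict h (e.toEquiv _ _ f.2) = D.restrict k (e.toEquiv _ _ f'.2)
    rw [← e.map_restrict, q, e.map_restrict])

theorem mapStalk_push {x : X} {V W : Opens X} (g : C.Hom V W) (c : C.Stalk x V) :
    e.mapStalk (C.push x g c) = D.push x (e.toEquiv V W g) (e.mapStalk c) :=
  Quotient.inductionOn c fun f => congrArg (D.germ x f.1.2) (e.map_comp g f.2)

theorem mapStalk_symm {x : X} {V : Opens X} (c : C.Stalk x V) :
    e.symm.mapStalk (e.mapStalk c) = c :=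
  Quotient.inductionOn c fun f =>
    congrArg (C.germ x f.1.2) ((e.toEquiv _ _).symm_apply_apply f.2)

/-- The map `C_x^y → D_x^y` induced by an isomorphism of categories over `X_top`. -/
def mapStarHom {x y : X} (a : C.StarHom x y) : D.StarHom x y where
  proj V hy := e.mapStalk (a.proj V hy)
  compat h hy := by rw [← e.map_incl, ← e.mapStalk_push, a.compat]

theorem mapStarHom_starComp {x y z : X} (b : C.StarHom y z) (a : C.StarHom x y) :
    e.mapStarHom (starComp b a) = starComp (e.mapStarHom b) (e.mapStarHom a) := by
  apply StarHom.ext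
  funext V hV
  change e.mapStalk (germComp (b.proj V hV) a) =
    germComp (e.mapStalk (b.proj V hV)) (e.mapStarHom a)
  generalize b.proj V hV = c
  exact Quotient.inductionOn c fun g => e.mapStalk_push g.2 _

theorem mapStarHom_symm {x y : X} (a : C.StarHom x y) :
    e.symm.mapStarHom (e.mapStarHom a) = a := by
  apply StarHom.ext
  funext V hV
  exact e.mapStalk_symm _

/-- The map on arrows of `C⋆` induced by an isomorphism of categories over `X_top`. -/
def mapStarArrow (a : C.StarArrow) : D.StarArrow := ⟨a.src, a.tgt, e.mapStarHom a.hom⟩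

theorem mapStarArrow_symm (a : C.StarArrow) : e.symm.mapStarArrow (e.mapStarArrow a) = a :=
  congrArg (StarArrow.mk a.src a.tgt) (e.mapStarHom_symm a.hom)

theorem mapStarArrow_mem {U V : Opens X} {f : C.Hom U V} {a : C.StarArrow}
    (ha : a ∈ germArrows f) : e.mapStarArrow a ∈ germArrows (e.toEquiv U V f) :=
  ⟨ha.1, ha.2.1, congrArg e.mapStalk ha.2.2⟩

theorem continuous_mapStarArrow : Continuous e.mapStarArrow := by
  refine continuous_starArrow_iff.2 fun U f => ?_
  -- The preimage of the germs of `f` is the set of germs of the morphism that `e` sends to `f`.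
  convert isOpen_germArrows_top (e.symm.toEquiv U ⊤ f)
  ext a
  constructor
  · intro h
    rw [← e.mapStarArrow_symm a]
    exact e.symm.mapStarArrow_mem h
  · intro h
    have := e.mapStarArrow_mem h
    rwa [show e.toEquiv U ⊤ (e.symm.toEquiv U ⊤ f) = f from
      (e.toEquiv U ⊤).apply_symm_apply f] at this

/-- The homeomorphism on arrows of `C⋆` induced by an isomorphism of categories over `X_top`. -/
def starHomeomorph : C.StarArrow ≃ₜ D.StarArrow where
  toFun := e.mapStarArrow
  invFun := e.symm.mapStarArrow
  left_inv := e.mapStarArrow_symm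
  right_inv := e.symm.mapStarArrow_symm
  continuous_toFun := e.continuous_mapStarArrow
  continuous_invFun := e.symm.continuous_mapStarArrow

end Iso

/-! ### Gluing morphisms of a pseudogroup sheaf -/

namespace IsPseudogroupSheaf

variable (hC : C.IsPseudogroupSheaf)

include hC

/-- Separatedness of the sheaf `C(-, V)`: equality of germs everywhere gives equality on a cover. -/
theorem hom_ext {U V : Opens X} {f f' : C.Hom U V}
    (h : ∀ x ∈ U, ∃ a : C.StarArrow, a.src = x ∧ a ∈ germArrows f ∧ a ∈ germArrows f') :
    f = f' := by
  have h' : ∀ x : U, ∃ (W : Opens X) (_ : (x : X) ∈ W) (k : W ≤ U),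
      C.restrict k f = C.restrict k f' := by
    intro x
    obtain ⟨a, hx, ha, ha'⟩ := h x x.2
    obtain ⟨W, hW, k, _, e⟩ := exists_restrict_eq ha ha'
    exact ⟨W, hx ▸ hW, k, e⟩
  choose W hW k e using h'
  exact TopCat.Sheaf.eq_of_locally_eq' (X := TopCat.of X) ⟨C.presheaf V, hC.sheaf V⟩ W U
    (fun x => homOfLE (k x)) (fun x hx => Opens.mem_iSup.2 ⟨⟨x, hx⟩, hW ⟨x, hx⟩⟩) f f' e

theorem exists_glue {U V : Opens X} {ι : Type u} (W : ι → Opens X) (k : ∀ i, W i ≤ U)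
    (hW : ∀ x ∈ U, ∃ i, x ∈ W i) (f : ∀ i, C.Hom (W i) V)
    (h : ∀ i j, ∀ x ∈ W i ⊓ W j,
      ∃ a : C.StarArrow, a.src = x ∧ a ∈ germArrows (f i) ∧ a ∈ germArrows (f j)) :
    ∃ g : C.Hom U V, ∀ i, C.restrict (k i) g = f i := by
  obtain ⟨g, hg, -⟩ := TopCat.Sheaf.existsUnique_gluing' (X := TopCat.of X)
    ⟨C.presheaf V, hC.sheaf V⟩ W U (fun i => homOfLE (k i))
    (fun x hx => Opens.mem_iSup.2 (hW x hx)) f (by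
      intro i j
      refine hC.hom_ext (f := C.restrict inf_le_left (f i)) (f' := C.restrict inf_le_right (f j))
        fun x hx => ?_
      obtain ⟨a, rfl, hi, hj⟩ := h i j x hx
      exact ⟨a, rfl, mem_germArrows_restrict _ hi hx, mem_germArrows_restrict _ hj hx⟩)
  exact ⟨g, hg⟩

/-- An idempotent in a groupoid is an identity, by cancelling with the inverse. -/
theorem eq_unit_of_comp_self {a : C.StarArrow} (h : a.src = a.tgt)
    (e : StarArrow.comp a a h = a) : a = StarArrow.unit C a.src := by
  have h1 := StarArrow.comp_assoc (hC.inv a) a a rfl h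
  simp only [hC.inv_comp, e] at h1
  obtain ⟨x, y, a⟩ := a
  obtain rfl : x = y := h
  exact (StarArrow.unit_comp _).symm.trans h1

theorem arrow_comp {U V W : Opens X} (g : C.Hom V W) (f : C.Hom U V) (x : U) :
    hC.arrow (C.comp g f) x =
      StarArrow.comp (hC.arrow g ⟨(hC.arrow f x).tgt, (hC.arrow_mem f x).2.1⟩) (hC.arrow f x)
        (hC.src_arrow _ _) :=
  hC.eq_of_mem_germArrows (hC.arrow_mem _ _)
    (StarArrow.comp_mem_germArrows _ (hC.arrow_mem _ _) (hC.arrow_mem _ _))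
    ((StarArrow.src_comp _ _ _).trans (hC.src_arrow f x)).symm

theorem arrow_incl {U V : Opens X} (h : U ≤ V) (x : U) :
    hC.arrow (C.incl h) x = StarArrow.unit C x :=
  hC.eq_of_mem_germArrows (hC.arrow_mem _ _) (StarArrow.unit_mem_germArrows_incl h x.2) rfl

end IsPseudogroupSheaf

end OpenCat

/-! ### From `G ≅ C⋆` to `C ≅ Ĝ` -/

namespace EtaleGroupoid.StarIso

variable {X : Type u} [TopologicalSpace X] {G G' : EtaleGroupoid X} {C D : OpenCat X}

theorem apply_comp (φ : G.StarIso C) (g f : G.Arr) (h : G.s g = G.t f) :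
    φ.toHomeomorph (G.comp g f h) = OpenCat.StarArrow.comp (φ.toHomeomorph g) (φ.toHomeomorph f)
      ((φ.src_eq g).trans (h.trans (φ.tgt_eq f).symm)) := by
  -- The composability proof mentions both arrows, so it is abstracted before they are destructured.
  generalize_proofs h'
  revert h'
  rcases hg : φ.toHomeomorph g with ⟨y, z, b⟩
  rcases hf : φ.toHomeomorph f with ⟨x, y', a⟩
  intro h'
  obtain rfl : y = y' := h'
  exact φ.map_comp x y z b a g f h hg hf

theorem of_apply_comp (φ : G.Arr ≃ₜ C.StarArrow) (hs : ∀ g, (φ g).src = G.s g)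
    (ht : ∀ g, (φ g).tgt = G.t g)
    (hc : ∀ (g f : G.Arr) (h : G.s g = G.t f), φ (G.comp g f h) =
      OpenCat.StarArrow.comp (φ g) (φ f) ((hs g).trans (h.trans (ht f).symm))) :
    Nonempty (G.StarIso C) := by
  refine ⟨⟨φ, hs, ht, fun x y z b a g f h hg hf => ?_⟩⟩
  have := hc g f h
  generalize_proofs h' at this
  revert h'
  rw [hg, hf]
  exact fun _ h => h

/-- Composition of an isomorphism `G ≅ C⋆` with the map induced by an isomorphism `C ≅ D`. -/
def transIso (φ : G.StarIso C) (e : OpenCat.Iso C D) : G.StarIso D where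
  toHomeomorph := φ.toHomeomorph.trans e.starHomeomorph
  src_eq := φ.src_eq
  tgt_eq := φ.tgt_eq
  map_comp x y z b a g f h hg hf := by
    have key : ∀ {x y : X} (b : D.StarHom x y) (g : G.Arr),
        e.mapStarArrow (φ.toHomeomorph g) = ⟨x, y, b⟩ →
          φ.toHomeomorph g = ⟨x, y, e.symm.mapStarHom b⟩ := fun b g hg => by
      rw [← e.mapStarArrow_symm (φ.toHomeomorph g), hg]
      rfl
    have := φ.map_comp x y z _ _ g f h (key b g hg) (key a f hf)
    change e.mapStarArrow (φ.toHomeomorph _) = _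
    rw [this, ← e.symm.mapStarHom_starComp]
    exact e.symm.mapStarArrow_symm ⟨x, z, OpenCat.starComp b a⟩

theorem s_symm (φ : G.StarIso C) (a : C.StarArrow) : G.s (φ.toHomeomorph.symm a) = a.src := by
  rw [← φ.src_eq, φ.toHomeomorph.apply_symm_apply]

theorem t_symm (φ : G.StarIso C) (a : C.StarArrow) : G.t (φ.toHomeomorph.symm a) = a.tgt := by
  rw [← φ.tgt_eq, φ.toHomeomorph.apply_symm_apply]

section Sections

variable (hC : C.IsPseudogroupSheaf) (φ : G.StarIso C)

include hC

/-- Preservation of units is not part of `StarIso`; it follows because units are idempotent. -/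
theorem apply_unit (x : X) : φ.toHomeomorph (G.unit x) = OpenCat.StarArrow.unit C x := by
  have h : G.s (G.unit x) = G.t (G.unit x) := (G.s_unit x).trans (G.t_unit x).symm
  have e : G.comp (G.unit x) (G.unit x) h = G.unit x :=
    (G.comp_congr rfl (congrArg G.unit (G.s_unit x).symm) h).trans (G.comp_unit (G.unit x))
  have h2 := φ.apply_comp _ _ h
  rw [e] at h2
  rw [hC.eq_unit_of_comp_self _ h2.symm, φ.src_eq, G.s_unit]

/-- The section of `G` defined by `f ∈ C(U, V)`. -/
noncomputable def toSect {U V : Opens X} (f : C.Hom U V) : G.Sect U V where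
  toFun x := φ.toHomeomorph.symm (hC.arrow f x)
  continuous := φ.toHomeomorph.symm.continuous.comp (hC.continuous_arrow f)
  s_apply x := φ.s_symm _
  t_mem x := by
    rw [φ.t_symm]
    exact (hC.arrow_mem f x).2.1

theorem toSect_injective {U V : Opens X} :
    Function.Injective (φ.toSect hC : C.Hom U V → G.Sect U V) := by
  refine fun f f' e => hC.hom_ext fun x hx => ⟨hC.arrow f ⟨x, hx⟩, rfl, hC.arrow_mem _ _, ?_⟩
  have := congrArg (fun σ : G.Sect U V => σ.toFun ⟨x, hx⟩) e
  rw [φ.toHomeomorph.symm.injective this]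
  exact hC.arrow_mem _ _

/-- Germs of a morphism form an open set, so a continuous section is locally given by morphisms of
`C`. They share their germs on overlaps and glue. -/
theorem toSect_surjective {U V : Opens X} :
    Function.Surjective (φ.toSect hC : C.Hom U V → G.Sect U V) := by
  intro σ
  have hsrc : ∀ x, (φ.toHomeomorph (σ.toFun x)).src = x := fun x =>
    (φ.src_eq _).trans (σ.s_apply x)
  have hex : ∀ x : U, ∃ (W : Opens X) (_ : (x : X) ∈ W) (k : W ≤ U) (f : C.Hom W V),
      ∀ y (hy : y ∈ W), φ.toHomeomorph (σ.toFun ⟨y, k hy⟩) ∈ OpenCat.germArrows f := by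
    intro x
    obtain ⟨U', f, hf⟩ := OpenCat.exists_mem_germArrows (φ.toHomeomorph (σ.toFun x)) (V := V)
      ((φ.tgt_eq _).symm ▸ σ.t_mem x)
    have hO : IsOpen ((fun y => φ.toHomeomorph (σ.toFun y)) ⁻¹' OpenCat.germArrows f) :=
      (hC.isOpen_germArrows f).preimage (φ.toHomeomorph.continuous.comp σ.continuous)
    let W : Opens X := ⟨Subtype.val '' ((fun y => φ.toHomeomorph (σ.toFun y)) ⁻¹'
      OpenCat.germArrows f), U.2.isOpenMap_subtype_val _ hO⟩
    have hWU : W ≤ U := by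
      rintro _ ⟨y, -, rfl⟩
      exact y.2
    have hWf : ∀ y (hy : y ∈ W), φ.toHomeomorph (σ.toFun ⟨y, hWU hy⟩) ∈ OpenCat.germArrows f := by
      rintro _ ⟨y, hy, rfl⟩
      exact hy
    have hWU' : W ≤ U' := fun y hy => by
      have := (hWf y hy).1
      rwa [hsrc] at this
    refine ⟨W, ⟨x, hf, rfl⟩, hWU, C.restrict hWU' f, fun y hy => ?_⟩
    refine OpenCat.mem_germArrows_restrict _ (hWf y hy) ?_
    rw [hsrc]
    exact hy
  choose W hxW k f hf using hex
  obtain ⟨g, hg⟩ := hC.exists_glue W k (fun x hx => ⟨⟨x, hx⟩, hxW _⟩) f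
    (fun i j x hx => ⟨_, hsrc ⟨x, k i hx.1⟩, hf i x hx.1, hf j x hx.2⟩)
  refine ⟨g, Sect.ext (funext fun x => ?_)⟩
  change φ.toHomeomorph.symm (hC.arrow g x) = _
  rw [Homeomorph.symm_apply_eq]
  have hm := hf x x (hxW x)
  rw [← hg x] at hm
  exact hC.eq_of_mem_germArrows (hC.arrow_mem g x) (OpenCat.mem_germArrows_of_mem_restrict _ hm)
    (hsrc x).symm

/-- An isomorphism `G ≅ C⋆` induces an isomorphism from `C` to the category of sections of `G`. -/
noncomputable def isoSections : OpenCat.Iso C G.sections where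
  toEquiv _ _ := Equiv.ofBijective (φ.toSect hC) ⟨φ.toSect_injective hC, φ.toSect_surjective hC⟩
  map_comp {U V W} g f := by
    refine Sect.ext (funext fun x => φ.toHomeomorph.injective ?_)
    refine Eq.trans ?_ (φ.apply_comp _ _ _).symm
    refine (φ.toHomeomorph.apply_symm_apply _).trans ((hC.arrow_comp g f x).trans ?_)
    congr 1
    · refine Eq.trans ?_ (φ.toHomeomorph.apply_symm_apply _).symm
      exact congrArg (hC.arrow g) (Subtype.ext (φ.t_symm _).symm)
    · exact (φ.toHomeomorph.apply_symm_apply _).symm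
  map_incl h := by
    refine Sect.ext (funext fun x => φ.toHomeomorph.injective ?_)
    exact (φ.toHomeomorph.apply_symm_apply _).trans
      ((hC.arrow_incl h x).trans (φ.apply_unit hC x).symm)

end Sections

end EtaleGroupoid.StarIso


/-! ### Smooth structures -/

variable {n : ℕ} {X : Type u} [TopologicalSpace X] [ChartedSpace (EuclideanSpace ℝ (Fin n)) X]

namespace EtaleLieGroupoid

theorem contMDiff_sect (G : EtaleLieGroupoid n X) {U V : Opens X}
    (f : G.toEtaleGroupoid.Sect U V) : ContMDiff (𝓡 n) (𝓡 n) ∞ f.toFun := by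
  refine contMDiff_of_comp_isLocalDiffeomorph G.isLocalDiffeomorph_s f.continuous ?_
  rw [show G.s ∘ f.toFun = Subtype.val from funext f.s_apply]
  exact contMDiff_subtype_val

/-- The smooth pseudogroup sheaf of sections of an étale Lie groupoid. -/
def pseudogroupSheaf [T1Space X] (G : EtaleLieGroupoid n X) : SmoothPseudogroupSheaf n X where
  toOpenCat := G.toEtaleGroupoid.sections
  isPseudogroupSheaf := G.toEtaleGroupoid.sections_isPseudogroupSheaf
  smooth {U V} f := by
    rw [← ContMDiff.subtypeVal_comp_iff]
    rw [show Subtype.val ∘ OpenCat.underlying G.toEtaleGroupoid.sections_isPseudogroupSheaf f =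
      G.t ∘ EtaleGroupoid.Sect.toFun f from funext (EtaleGroupoid.underlying_sections G.toEtaleGroupoid f)]
    exact G.isLocalDiffeomorph_t.contMDiff.comp (G.contMDiff_sect f)

/-- Composing with the source of `G'` gives the source of `G`, which is smooth. -/
theorem contMDiff_of_homeomorph {G G' : EtaleLieGroupoid n X} (ψ : G.Arr ≃ₜ G'.Arr)
    (hs : ∀ g, G'.s (ψ g) = G.s g) : ContMDiff (𝓡 n) (𝓡 n) ∞ ψ := by
  refine contMDiff_of_comp_isLocalDiffeomorph G'.isLocalDiffeomorph_s ψ.continuous ?_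
  rw [show G'.s ∘ ψ = G.s from funext hs]
  exact G.isLocalDiffeomorph_s.contMDiff

/-- Two étale Lie groupoids isomorphic to `C⋆` as topological groupoids are isomorphic. -/
noncomputable def isoOfStarIso {G G' : EtaleLieGroupoid n X} {C : OpenCat X}
    (φ : G.toEtaleGroupoid.StarIso C) (φ' : G'.toEtaleGroupoid.StarIso C) : Iso G G' where
  toDiffeo :=
    { toEquiv := (φ.toHomeomorph.trans φ'.toHomeomorph.symm).toEquiv
      contMDiff_toFun := contMDiff_of_homeomorph (φ.toHomeomorph.trans φ'.toHomeomorph.symm)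
        fun g => (φ'.s_symm _).trans (φ.src_eq g)
      contMDiff_invFun := contMDiff_of_homeomorph (φ'.toHomeomorph.trans φ.toHomeomorph.symm)
        fun g => (φ.s_symm _).trans (φ'.src_eq g) }
  s_map g := (φ'.s_symm _).trans (φ.src_eq g)
  t_map g := (φ'.t_symm _).trans (φ.tgt_eq g)
  map_comp g f h := by
    apply φ'.toHomeomorph.injective
    refine (φ'.toHomeomorph.apply_symm_apply _).trans ((φ.apply_comp g f h).trans ?_)
    refine Eq.trans ?_ (φ'.apply_comp _ _ _).symm
    congr 1
    · exact (φ'.toHomeomorph.apply_symm_apply _).symm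
    · exact (φ'.toHomeomorph.apply_symm_apply _).symm

theorem nonempty_starIso_of_iso {G G' : EtaleLieGroupoid n X} (e : Iso G G') {C : OpenCat X}
    (φ : G'.toEtaleGroupoid.StarIso C) : Nonempty (G.toEtaleGroupoid.StarIso C) := by
  refine EtaleGroupoid.StarIso.of_apply_comp (e.toDiffeo.toHomeomorph.trans φ.toHomeomorph)
    (fun g => (φ.src_eq _).trans (e.s_map g)) (fun g => (φ.tgt_eq _).trans (e.t_map g))
    fun g f h => ?_
  exact (congrArg φ.toHomeomorph (e.map_comp g f h)).trans (φ.apply_comp _ _ _)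

end EtaleLieGroupoid

/-! ### `C⋆` as an étale Lie groupoid -/

namespace SmoothPseudogroupSheaf

variable (C : SmoothPseudogroupSheaf n X)

/-- The smooth structure on the set of arrows of `C⋆`. -/
@[reducible]
noncomputable def chartedSpaceStarArrow :
    ChartedSpace (EuclideanSpace ℝ (Fin n)) C.toOpenCat.StarArrow :=
  pullbackChartedSpace _ C.isPseudogroupSheaf.isLocalHomeomorph_src

theorem compExt_eq {p : C.toOpenCat.StarArrow × C.toOpenCat.StarArrow} (hp : p.1.src = p.2.tgt) :
    C.isPseudogroupSheaf.starGroupoid.compExt p = OpenCat.StarArrow.comp p.1 p.2 hp :=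
  dif_pos hp

variable [IsManifold (𝓡 n) ∞ X]

theorem isLocalDiffeomorph_src :
    letI := C.chartedSpaceStarArrow
    IsLocalDiffeomorph (𝓡 n) (𝓡 n) ∞ (OpenCat.StarArrow.src : C.toOpenCat.StarArrow → X) :=
  isLocalDiffeomorph_pullbackChartedSpace C.isPseudogroupSheaf.isLocalHomeomorph_src

/-- On the germs of `f` the target map is `f̄` after the source map. This is the one use of the
smoothness of `C`. -/
theorem contMDiff_tgt :
    letI := C.chartedSpaceStarArrow
    ContMDiff (𝓡 n) (𝓡 n) ∞ (OpenCat.StarArrow.tgt : C.toOpenCat.StarArrow → X) := by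
  let := C.chartedSpaceStarArrow
  intro a
  classical
  obtain ⟨U, f, haf⟩ := OpenCat.exists_mem_germArrows a (V := ⊤) trivial
  -- `F` extends `f̄` to all of `X`; its values off `U` play no role.
  let F : X → X := fun x => if h : x ∈ U then (C.isPseudogroupSheaf.arrow f ⟨x, h⟩).tgt else x
  have hFU : ∀ x (h : x ∈ U), F x = (C.isPseudogroupSheaf.arrow f ⟨x, h⟩).tgt :=
    fun x h => dif_pos h
  have hF : ContMDiffAt (𝓡 n) (𝓡 n) ∞ F a.src := by
    refine (contMDiffAt_subtype_iff (U := U) (x := ⟨a.src, haf.1⟩)).1 ?_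
    rw [show (fun x : U => F x) =
      Subtype.val ∘ OpenCat.underlying C.isPseudogroupSheaf f from funext fun x => hFU x x.2]
    exact contMDiff_subtype_val.comp (C.smooth f) _
  refine (hF.comp a C.isLocalDiffeomorph_src.contMDiff.contMDiffAt).congr_of_eventuallyEq ?_
  filter_upwards [(C.isPseudogroupSheaf.isOpen_germArrows f).mem_nhds haf] with b hb
  refine (congrArg OpenCat.StarArrow.tgt (C.isPseudogroupSheaf.eq_arrow hb)).trans ?_
  exact (hFU _ hb.1).symm

theorem contMDiff_inv :
    letI := C.chartedSpaceStarArrow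
    ContMDiff (𝓡 n) (𝓡 n) ∞ C.isPseudogroupSheaf.inv :=
  letI := C.chartedSpaceStarArrow
  contMDiff_of_comp_isLocalDiffeomorph C.isLocalDiffeomorph_src C.isPseudogroupSheaf.continuous_inv
    C.contMDiff_tgt

/-- The inversion of `C⋆` as a diffeomorphism. -/
noncomputable def invDiffeomorph :
    letI := C.chartedSpaceStarArrow
    Diffeomorph (𝓡 n) (𝓡 n) C.toOpenCat.StarArrow C.toOpenCat.StarArrow ∞ :=
  letI := C.chartedSpaceStarArrow
  { toEquiv := C.isPseudogroupSheaf.invHomeomorph.toEquiv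
    contMDiff_toFun := C.contMDiff_inv
    contMDiff_invFun := C.contMDiff_inv }

/-- The source of `b ∘ a` is the source of `a`, a smooth function of the pair; continuity lifts this
to composition itself. -/
theorem contMDiffOn_comp :
    letI := C.chartedSpaceStarArrow
    ContMDiffOn (M := C.toOpenCat.StarArrow × C.toOpenCat.StarArrow) (M' := C.toOpenCat.StarArrow)
      ((𝓡 n).prod (𝓡 n)) (𝓡 n) ∞ C.isPseudogroupSheaf.starGroupoid.compExt
      {p | p.1.src = p.2.tgt} := by
  let := C.chartedSpaceStarArrow
  intro p hp
  have key : ∀ p ∈ {p : C.toOpenCat.StarArrow × C.toOpenCat.StarArrow | p.1.src = p.2.tgt},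
      OpenCat.StarArrow.src (C.isPseudogroupSheaf.starGroupoid.compExt p) = p.2.src := fun p hp =>
    (congrArg OpenCat.StarArrow.src (C.compExt_eq hp)).trans (OpenCat.StarArrow.src_comp _ _ _)
  refine contMDiffWithinAt_of_comp_isLocalDiffeomorph C.isLocalDiffeomorph_src ?_ ?_
  · refine ContinuousOn.continuousWithinAt ?_ hp
    refine continuousOn_iff_continuous_domRestrict.2 ?_
    exact C.isPseudogroupSheaf.continuous_comp.congr fun q => (C.compExt_eq q.2).symm
  · exact ((C.isLocalDiffeomorph_src.contMDiff.comp contMDiff_snd) p).contMDiffWithinAt.congr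
      key (key p hp)

/-- The étale Lie groupoid `C⋆`. -/
noncomputable def lieGroupoid : EtaleLieGroupoid n X :=
  letI := C.chartedSpaceStarArrow
  { toEtaleGroupoid := C.isPseudogroupSheaf.starGroupoid
    charted := C.chartedSpaceStarArrow
    isManifold := isManifold_pullbackChartedSpace C.isPseudogroupSheaf.isLocalHomeomorph_src
    isLocalDiffeomorph_s := C.isLocalDiffeomorph_src
    -- The target is the source after inversion.
    isLocalDiffeomorph_t := fun a =>
      (C.invDiffeomorph.isLocalDiffeomorph a).comp (𝓡 n) X (C.isLocalDiffeomorph_src _)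
    contMDiff_unit := contMDiff_of_comp_isLocalDiffeomorph C.isLocalDiffeomorph_src
      OpenCat.StarArrow.continuous_unit contMDiff_id
    contMDiff_inv := C.contMDiff_inv
    contMDiffOn_comp := C.contMDiffOn_comp }

theorem nonempty_starIso_lieGroupoid :
    Nonempty (C.lieGroupoid.toEtaleGroupoid.StarIso C.toOpenCat) :=
  EtaleGroupoid.StarIso.of_apply_comp (Homeomorph.refl _) (fun _ => rfl) (fun _ => rfl)
    fun _ _ _ => rfl

end SmoothPseudogroupSheaf

end EtalePG

/-! ### The correspondence on isomorphism classes -/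

theorem mainTheorem9 (n : ℕ) (X : Type u) [TopologicalSpace X]
    [ChartedSpace (EuclideanSpace ℝ (Fin n)) X] [IsManifold (𝓡 n) ∞ X] :
    ∃ Φ : Quotient (EtalePG.EtaleLieGroupoid.isoSetoid n X) ≃
        Quotient (EtalePG.SmoothPseudogroupSheaf.isoSetoid n X),
      ∀ (G : EtalePG.EtaleLieGroupoid n X) (C : EtalePG.SmoothPseudogroupSheaf n X),
        (Φ (Quotient.mk _ G) = Quotient.mk _ C ↔
          Nonempty (EtalePG.OpenCat.Iso G.toEtaleGroupoid.sections C.toOpenCat)) ∧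
        (Φ.symm (Quotient.mk _ C) = Quotient.mk _ G ↔
          Nonempty (EtalePG.EtaleGroupoid.StarIso G.toEtaleGroupoid C.toOpenCat)) := by
  have : T1Space X := ChartedSpace.t1Space (EuclideanSpace ℝ (Fin n)) X
  have star_of_iso : ∀ (G : EtalePG.EtaleLieGroupoid n X) (C : EtalePG.SmoothPseudogroupSheaf n X),
      Nonempty (EtalePG.OpenCat.Iso G.toEtaleGroupoid.sections C.toOpenCat) →
        Nonempty (EtalePG.EtaleGroupoid.StarIso G.toEtaleGroupoid C.toOpenCat) :=
    fun G C ⟨e⟩ => ⟨G.toEtaleGroupoid.starIsoSections.transIso e⟩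
  have iso_of_star : ∀ (G : EtalePG.EtaleLieGroupoid n X) (C : EtalePG.SmoothPseudogroupSheaf n X),
      Nonempty (EtalePG.EtaleGroupoid.StarIso G.toEtaleGroupoid C.toOpenCat) →
        Nonempty (EtalePG.OpenCat.Iso G.toEtaleGroupoid.sections C.toOpenCat) :=
    fun G C ⟨φ⟩ => ⟨(φ.isoSections C.isPseudogroupSheaf).symm⟩
  let Φ₀ : Quotient (EtalePG.EtaleLieGroupoid.isoSetoid n X) →
      Quotient (EtalePG.SmoothPseudogroupSheaf.isoSetoid n X) :=
    -- For `G ≅ G'`, the composite `G ≅ G' ≅ Ĝ'⋆` yields an isomorphism between the categories of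
    -- sections.
    Quotient.map EtalePG.EtaleLieGroupoid.pseudogroupSheaf fun G G' ⟨e⟩ =>
      iso_of_star G G'.pseudogroupSheaf
        (EtalePG.EtaleLieGroupoid.nonempty_starIso_of_iso e G'.toEtaleGroupoid.starIsoSections)
  have hΦ₀ : ∀ (G : EtalePG.EtaleLieGroupoid n X) (C : EtalePG.SmoothPseudogroupSheaf n X),
      Φ₀ (Quotient.mk _ G) = Quotient.mk _ C ↔
        Nonempty (EtalePG.OpenCat.Iso G.toEtaleGroupoid.sections C.toOpenCat) :=
    fun G C => ⟨fun h => Quotient.exact h, fun h => Quotient.sound h⟩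
  have hbij : Function.Bijective Φ₀ := by
    constructor
    · intro q q'
      refine Quotient.inductionOn₂ q q' fun G G' h => Quotient.sound ?_
      -- Both `G` and `G'` are now topologically isomorphic to `Ĝ'⋆`, which makes them
      -- diffeomorphic.
      obtain ⟨φ⟩ := star_of_iso G G'.pseudogroupSheaf ((hΦ₀ G G'.pseudogroupSheaf).1 h)
      exact ⟨EtalePG.EtaleLieGroupoid.isoOfStarIso φ G'.toEtaleGroupoid.starIsoSections⟩
    · intro q
      refine Quotient.inductionOn q fun C => ⟨Quotient.mk _ C.lieGroupoid, ?_⟩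
      exact (hΦ₀ _ _).2 (iso_of_star _ _ C.nonempty_starIso_lieGroupoid)
  refine ⟨Equiv.ofBijective Φ₀ hbij, fun G C => ⟨hΦ₀ G C, ?_⟩⟩
  rw [Equiv.symm_apply_eq, eq_comm]
  exact (hΦ₀ G C).trans ⟨star_of_iso G C, iso_of_star G C⟩
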